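/- **Setting.** Let $\mathbb{C}^{2,1}$ be $\mathbb{C}^3$ with the Hermitian form $\langle \mathbf z,\mathbf w\rangle=z_1\overline{w_3}+z_2\overline{w_2}+z_3\overline{w_1}$ of signature $(2,1)$. Let $\partial\mathbf H^2_{\mathbb C}\cong S^3$ be the set of null lines in $\mathbb{P}(\mathbb{C}^{2,1})$ and let $\mathrm{PU}(2,1)$ be the image of the unitary group of the form in $\mathrm{PGL}(3,\mathbb C)$. A point $(z,t)\in\mathbb C\times\mathbb R$ denotes the boundary point $[-|z|^2+it,\ \sqrt2\,z,\ 1]$; also $0=(0,0)$ and $\infty=[1,0,0]$. A $\mathbb C$-circle is the intersection of $\partial\mathbf H^2_{\mathbb C}$ with a complex projective line containing a negative vector. Let $\mathfrak C_4''$ be the set of quadruples $(p_1,p_2,p_3,p_4)$ of pairwise distinct points of $\partial\mathbf H^2_{\mathbb C}$ such that $p_1,p_2,p_3$ do not lie on a common $\mathbb C$-circle, $p_2,p_3,p_4$ do not lie on a common $\mathbb C$-circle, and $p_4$ is not in the orbit of $p_1$ under the pointwise stabiliser of $p_2$ and $p_3$ in $\mathrm{PU}(2,1)$. Let $\mathfrak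 F_4''$ be the set of $\mathrm{PU}(2,1)$-orbits (for the diagonal action) of quadruples in $\mathfrak C_4''$. Let $\mathfrak H^\star$ be the affine-rotational group: the manifold $\mathbb C_*\times\mathbb R$ with $(z,t)\star(w,s)=(zw,\,t+s|z|^2)$. With $z=x+iy$ put $$\phi^\star=\frac{d(|z|^2)}{2|z|^2},\qquad \psi^\star=-\frac{dt}{2|z|^2},\qquad \omega^\star=\frac{dt+2x\,dy-2y\,dx}{2|z|^2},\qquad g^\star=(\phi^\star)^2+(\psi^\star)^2+(\omega^\star)^2,$$ and let $$\mathbf X=x\partial_x+y\partial_y,\qquad \mathbf Y=x\partial_y-y\partial_x-2|z|^2\partial_t,\qquad \mathbf T=x\partial_y-y\partial_x$$ be the dual frame. On the cone $\mathcal C(\mathfrak H^\star)=\mathfrak H^\star\times\mathbb R_{>0}$, with coordinate $r$ on the second factor, consider the metric $g_r=dr^2+r^2g^\star$, the almost complex structure $\mathbb J$ with $\mathbb J\mathbf X=\mathbf Y$, $\mathbb J\mathbf Y=-\mathbf X$, $\mathbb J\mathbf T=-r\partial_r$, $\mathbb J(r\partial_r)=\mathbf T$, and the 2-form $\Omega_r=d\left(\tfrac{r^2}{2}\omega^\star\right)$.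 Let $\mathcal C'(\mathfrak H^\star)=\mathcal C(\mathfrak H^\star)\setminus\{(z,t,r):\log r=t/|z|^2\}$, an open subset of the cone. **Theorem.** $(\mathbb J,g_r,\Omega_r)$ is a Kähler structure on $\mathcal C(\mathfrak H^\star)$ and, by restriction, on $\mathcal C'(\mathfrak H^\star)$: $\mathbb J$ is an integrable complex structure, $g_r$ is a smooth Riemannian metric with $g_r(\mathbb J u,\mathbb J v)=g_r(u,v)$, and $\Omega_r(u,v)=g_r(\mathbb J u,v)$ is closed. Moreover, there is a bijection $$\mathcal B_0:\mathfrak F_4''\to\mathcal C'(\mathfrak H^\star)$$ such that every class in $\mathfrak F_4''$ is the class of some quadruple in $\mathfrak C_4''$ of the form $$p_1=(1,\tan a),\quad p_2=\infty,\quad p_3=0,\quad p_4=(z,t),\qquad a\in(-\pi/2,\pi/2),\ z\in\mathbb C,\ t\in\mathbb R,$$ and $\mathcal B_0$ sends the class of any such quadruple to $(z,t,e^{\tan a})$. Through $\mathcal B_0$ the set $\mathfrak F_4''$ inherits the Kähler structure of $\mathcal C'(\mathfrak H^\star)$: there are a smooth manifold structure and a Kähler structure on $\mathfrak F_4''$ for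 which $\mathcal B_0$ is a diffeomorphism that respects the complex structures, the metrics and the Kähler forms. -/

import Mathlib

open scoped Manifold ContDiff MatrixGroups LinearAlgebra.Projectivization Topology

noncomputable section

namespace ConfKahler

/-! ### The complex hyperbolic plane, its boundary and the group `PU(2,1)` -/

/-- The vector space underlying `ℂ^{2,1}`. -/
abbrev C21 : Type := Fin 3 → ℂ

/-- The matrix of the Hermitian form of signature `(2,1)`. -/
def hermMatrix : Matrix (Fin 3) (Fin 3) ℂ := !![0, 0, 1; 0, 1, 0; 1, 0, 0]

/-- The Hermitian form `⟨z, w⟩ = w* H z`. -/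
def herm (z w : C21) : ℂ := star w ⬝ᵥ (hermMatrix.mulVec z)

/-- The boundary `∂H²_ℂ ≅ S³`: the null lines of `ℂ^{2,1}`. -/
def boundary : Set (ℙ ℂ C21) := {p | herm p.rep p.rep = 0}

open scoped Matrix in
/-- The group `U(2,1)` of matrices preserving the Hermitian form. -/
def U21 : Subgroup (GL (Fin 3) ℂ) where
  carrier := {A | (A : Matrix (Fin 3) (Fin 3) ℂ)ᴴ * hermMatrix * (A : Matrix (Fin 3) (Fin 3) ℂ)
    = hermMatrix}
  one_mem' := by simp
  mul_mem' := by
    intro A B hA hB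
    simp only [Set.mem_ofPred_eq] at hA hB ⊢
    calc _ = (B : Matrix (Fin 3) (Fin 3) ℂ)ᴴ * ((A : Matrix (Fin 3) (Fin 3) ℂ)ᴴ * hermMatrix *
          (A : Matrix (Fin 3) (Fin 3) ℂ)) * (B : Matrix (Fin 3) (Fin 3) ℂ) := by
            simp [Matrix.conjTranspose_mul, Matrix.mul_assoc]
      _ = hermMatrix := by rw [hA, hB]
  inv_mem' := by
    intro A hA
    simp only [Set.mem_ofPred_eq] at hA ⊢
    have h1 : (A : Matrix (Fin 3) (Fin 3) ℂ) * ((A⁻¹ : GL (Fin 3) ℂ) : Matrix (Fin 3) (Fin 3) ℂ)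
        = 1 := by
      rw [← Units.val_mul, mul_inv_cancel, Units.val_one]
    have h2 : ((A⁻¹ : GL (Fin 3) ℂ) : Matrix (Fin 3) (Fin 3) ℂ)ᴴ *
        (A : Matrix (Fin 3) (Fin 3) ℂ)ᴴ = 1 := by
      rw [← Matrix.conjTranspose_mul, h1, Matrix.conjTranspose_one]
    generalize ((A⁻¹ : GL (Fin 3) ℂ) : Matrix (Fin 3) (Fin 3) ℂ) = B at h1 h2 ⊢
    calc Bᴴ * hermMatrix * B = Bᴴ * ((A : Matrix (Fin 3) (Fin 3) ℂ)ᴴ * hermMatrix *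
          (A : Matrix (Fin 3) (Fin 3) ℂ)) * B := by rw [hA]
      _ = (Bᴴ * (A : Matrix (Fin 3) (Fin 3) ℂ)ᴴ) * hermMatrix *
          ((A : Matrix (Fin 3) (Fin 3) ℂ) * B) := by simp only [Matrix.mul_assoc]
      _ = hermMatrix := by rw [h1, h2, Matrix.one_mul, Matrix.mul_one]

/-- `PU(2,1)`, the image of `U(2,1)` in `PGL(3, ℂ)`. It acts on the complex projective plane by
restriction of the action of `PGL(3, ℂ)`, and preserves `boundary`. -/
def PU21 : Subgroup PGL(3, ℂ) := U21.map Matrix.ProjGenLinGroup.mk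

/-- A `ℂ`-circle: the intersection with the boundary of a complex geodesic, that is, of a complex
projective line which meets `H²_ℂ`. -/
def IsCCircle (C : Set (ℙ ℂ C21)) : Prop :=
  ∃ W : Submodule ℂ C21, Module.finrank ℂ W = 2 ∧ (∃ v ∈ W, (herm v v).re < 0) ∧
    C = {p | p ∈ boundary ∧ p.submodule ≤ W}

/-- The three points lie on a common `ℂ`-circle. -/
def OnCCircle (p q s : ℙ ℂ C21) : Prop :=
  ∃ C, IsCCircle C ∧ p ∈ C ∧ q ∈ C ∧ s ∈ C

/-- The point of the boundary with Heisenberg coordinates `(z, t)`, given by its standard lift. -/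
def heis (z : ℂ) (t : ℝ) : ℙ ℂ C21 :=
  Projectivization.mk ℂ
    ![-((‖z‖ ^ 2 : ℝ) : ℂ) + Complex.I * (t : ℂ), ((√2 : ℝ) : ℂ) * z, 1]
    (fun h => one_ne_zero (congrFun h 2))

/-- The point at infinity of the boundary. -/
def inftyPt : ℙ ℂ C21 :=
  Projectivization.mk ℂ ![1, 0, 0] (fun h => one_ne_zero (congrFun h 0))

/-! ### The configuration space -/

/-- Ordered quadruples of pairwise distinct points of the boundary. -/
def C4 : Set (Fin 4 → ℙ ℂ C21) :=
  {p | Function.Injective p ∧ ∀ i, p i ∈ boundary}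

/-- Quadruples `(p 0, p 1, p 2, p 3)` such that neither the first three points nor the last
three points lie on a common `ℂ`-circle, and such that the first and the last point are not in the same
orbit of the (pointwise) stabiliser of the two middle ones. -/
def C4'' : Set (Fin 4 → ℙ ℂ C21) :=
  {p | p ∈ C4 ∧ ¬ OnCCircle (p 0) (p 1) (p 2) ∧ ¬ OnCCircle (p 1) (p 2) (p 3) ∧
    p 3 ∉ MulAction.orbit
      ↥(MulAction.stabilizer ↥PU21 (p 1) ⊓ MulAction.stabilizer ↥PU21 (p 2)) (p 0)}

/-- The `PU(2,1)`-orbit of a quadruple, for the diagonal action. -/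
def config (p : Fin 4 → ℙ ℂ C21) : MulAction.orbitRel.Quotient ↥PU21 (Fin 4 → ℙ ℂ C21) :=
  Quotient.mk _ p

/-- The configuration space `𝔉₄''`: the set of `PU(2,1)`-orbits of quadruples in `C4''`. -/
def F4'' : Set (MulAction.orbitRel.Quotient ↥PU21 (Fin 4 → ℙ ℂ C21)) := config '' C4''

/-- The normalised quadruple `(1, tan a), ∞, (0, 0), (z, t)`. -/
def normalQuad (a : ℝ) (z : ℂ) (t : ℝ) : Fin 4 → ℙ ℂ C21 :=
  ![heis 1 (Real.tan a), inftyPt, heis 0 0, heis z t]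

/-! ### The affine-rotational group and its contact Riemannian structure -/

/-- The underlying manifold `ℂ_* × ℝ` of the affine-rotational group `ℌ*`. -/
def HStar : TopologicalSpace.Opens (ℂ × ℝ) :=
  ⟨{p | p.1 ≠ 0}, isOpen_ne_fun continuous_fst continuous_const⟩

/-- The group law `(z, t) ⋆ (w, s) = (z w, t + s |z|²)`. -/
instance : Group HStar where
  mul p q := ⟨(p.1.1 * q.1.1, p.1.2 + q.1.2 * ‖p.1.1‖ ^ 2), mul_ne_zero p.2 q.2⟩
  one := ⟨(1, 0), one_ne_zero⟩
  inv p := ⟨(p.1.1⁻¹, -p.1.2 / ‖p.1.1‖ ^ 2), inv_ne_zero p.2⟩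
  mul_assoc p q s := by
    apply Subtype.ext
    apply Prod.ext
    · exact mul_assoc p.1.1 q.1.1 s.1.1
    · change p.1.2 + q.1.2 * ‖p.1.1‖ ^ 2 + s.1.2 * ‖p.1.1 * q.1.1‖ ^ 2
        = p.1.2 + (q.1.2 + s.1.2 * ‖q.1.1‖ ^ 2) * ‖p.1.1‖ ^ 2
      rw [norm_mul]; ring
  one_mul p := by
    apply Subtype.ext
    apply Prod.ext
    · exact one_mul p.1.1
    · change (0 : ℝ) + p.1.2 * ‖(1 : ℂ)‖ ^ 2 = p.1.2
      simp
  mul_one p := by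
    apply Subtype.ext
    apply Prod.ext
    · exact mul_one p.1.1
    · change p.1.2 + 0 * ‖p.1.1‖ ^ 2 = p.1.2
      simp
  inv_mul_cancel p := by
    apply Subtype.ext
    apply Prod.ext
    · exact inv_mul_cancel₀ p.2
    · change -p.1.2 / ‖p.1.1‖ ^ 2 + p.1.2 * ‖p.1.1⁻¹‖ ^ 2 = 0
      rw [norm_inv]; ring

/-- The left-invariant field `X = x ∂/∂x + y ∂/∂y`. -/
def fieldX (p : ℂ × ℝ) : ℂ × ℝ := (p.1, 0)

/-- The left-invariant field `Y = x ∂/∂y - y ∂/∂x - 2|z|² ∂/∂t`. -/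
def fieldY (p : ℂ × ℝ) : ℂ × ℝ := (Complex.I * p.1, -2 * ‖p.1‖ ^ 2)

/-- The Reeb field `T = x ∂/∂y - y ∂/∂x`. -/
def fieldT (p : ℂ × ℝ) : ℂ × ℝ := (Complex.I * p.1, 0)

/-- The coordinate differential `dx` on `ℂ × ℝ`, where `z = x + i y`. -/
def dx : ℂ × ℝ →L[ℝ] ℝ := Complex.reCLM.comp (ContinuousLinearMap.fst ℝ ℂ ℝ)

/-- The coordinate differential `dy`. -/
def dy : ℂ × ℝ →L[ℝ] ℝ := Complex.imCLM.comp (ContinuousLinearMap.fst ℝ ℂ ℝ)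

/-- The coordinate differential `dt`. -/
def dt : ℂ × ℝ →L[ℝ] ℝ := ContinuousLinearMap.snd ℝ ℂ ℝ

/-- `φ* = d(|z|²) / (2|z|²)`. -/
def phiStar (p : ℂ × ℝ) : ℂ × ℝ →L[ℝ] ℝ :=
  (1 / (2 * ‖p.1‖ ^ 2)) • ((2 * p.1.re) • dx + (2 * p.1.im) • dy)

/-- `ψ* = - dt / (2|z|²)`. -/
def psiStar (p : ℂ × ℝ) : ℂ × ℝ →L[ℝ] ℝ :=
  (-(1 / (2 * ‖p.1‖ ^ 2))) • dt

/-- The contact form `ω* = (dt + 2x dy - 2y dx) / (2|z|²)`. -/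
def omegaStar (p : ℂ × ℝ) : ℂ × ℝ →L[ℝ] ℝ :=
  (1 / (2 * ‖p.1‖ ^ 2)) • (dt + (2 * p.1.re) • dy - (2 * p.1.im) • dx)

/-- The Riemannian metric `g* = (φ*)² + (ψ*)² + (ω*)²`. -/
def gStar (p : ℂ × ℝ) : ℂ × ℝ →L[ℝ] ℂ × ℝ →L[ℝ] ℝ :=
  (phiStar p).smulRight (phiStar p) + (psiStar p).smulRight (psiStar p) +
    (omegaStar p).smulRight (omegaStar p)

/-- The endomorphism `Φ*` with `X ↦ Y`, `Y ↦ -X`, `T ↦ 0`. -/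
def PhiStar (p : ℂ × ℝ) : ℂ × ℝ →L[ℝ] ℂ × ℝ :=
  (phiStar p).smulRight (fieldY p) - (psiStar p).smulRight (fieldX p)

/-! ### The cone over the affine-rotational group -/

/-- The ambient space of the cone: points are `((z, t), r)`. -/
abbrev ConeSpace : Type := (ℂ × ℝ) × ℝ

/-- The cone `𝒞(ℌ*) = ℌ* × ℝ_{>0}`. -/
def cone : TopologicalSpace.Opens ConeSpace :=
  ⟨{q | q.1 ∈ HStar ∧ 0 < q.2},
    (HStar.isOpen.preimage continuous_fst).inter (isOpen_lt continuous_const continuous_snd)⟩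

/-- The cone metric `dr² + r² g*`. -/
def coneMetric (q : ConeSpace) : ConeSpace →L[ℝ] ConeSpace →L[ℝ] ℝ :=
  (ContinuousLinearMap.snd ℝ (ℂ × ℝ) ℝ).smulRight (ContinuousLinearMap.snd ℝ (ℂ × ℝ) ℝ) +
    q.2 ^ 2 • (gStar q.1).bilinearComp (ContinuousLinearMap.fst ℝ (ℂ × ℝ) ℝ)
      (ContinuousLinearMap.fst ℝ (ℂ × ℝ) ℝ)

/-- The almost complex structure `𝕁` of the cone: `X ↦ Y`, `Y ↦ -X`, `T ↦ - r ∂/∂r` and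
`r ∂/∂r ↦ T`. -/
def coneJ (q : ConeSpace) : ConeSpace →L[ℝ] ConeSpace :=
  ((PhiStar q.1).comp (ContinuousLinearMap.fst ℝ (ℂ × ℝ) ℝ) +
      (q.2⁻¹ • ContinuousLinearMap.snd ℝ (ℂ × ℝ) ℝ).smulRight (fieldT q.1)).prod
    (-(q.2 • (omegaStar q.1).comp (ContinuousLinearMap.fst ℝ (ℂ × ℝ) ℝ)))

/-- The fundamental form `Ω = d(r² ω* / 2)` of the cone. -/
def coneForm (q : ConeSpace) : ConeSpace [⋀^Fin 2]→L[ℝ] ℝ :=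
  extDeriv (fun q' : ConeSpace => ContinuousAlternatingMap.ofSubsingleton ℝ ConeSpace ℝ (0 : Fin 1)
    ((q'.2 ^ 2 / 2) • (omegaStar q'.1).comp (ContinuousLinearMap.fst ℝ (ℂ × ℝ) ℝ))) q

/-- The open subset `𝒞'(ℌ*)` of the cone obtained by removing `{log r = t / |z|²}`. -/
def cone' : TopologicalSpace.Opens ConeSpace :=
  ⟨{q | q ∈ cone ∧ Real.log q.2 ≠ q.1.2 / ‖q.1.1‖ ^ 2}, by
    have h : ContinuousOn (fun q : ConeSpace => Real.log q.2 - q.1.2 / ‖q.1.1‖ ^ 2)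
        (cone : Set ConeSpace) := by
      apply ContinuousOn.sub
      · exact ContinuousOn.log continuous_snd.continuousOn (fun q hq => hq.2.ne')
      · refine ContinuousOn.div (by fun_prop) (by fun_prop) (fun q hq => ?_)
        exact pow_ne_zero 2 (norm_ne_zero_iff.mpr hq.1)
    have h2 := h.isOpen_inter_preimage cone.isOpen (isOpen_compl_singleton (x := (0 : ℝ)))
    convert h2 using 1
    ext q
    simp [sub_eq_zero]⟩

/-! ### Kähler structures on real four-dimensional manifolds -/

/-- The tangent space at `p` of a manifold modelled on `ConeSpace`. -/
abbrev Tan {M : Type} [TopologicalSpace M] [ChartedSpace ConeSpace M] (p : M) : Type :=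
  TangentSpace 𝓘(ℝ, ConeSpace) p

/-- Multiplication by `i` on `ℂ²`. -/
def mulI : ℂ × ℂ →L[ℝ] ℂ × ℂ :=
  (Complex.I • ContinuousLinearMap.id ℂ (ℂ × ℂ)).restrictScalars ℝ

/-- The representation of a field of alternating 2-forms in a chart `e`, that is, its pullback by
the inverse of `e`. -/
def chartForm {M : Type} [TopologicalSpace M] [ChartedSpace ConeSpace M]
    (Ω : ∀ p : M, Tan p [⋀^Fin 2]→L[ℝ] ℝ) (e : OpenPartialHomeomorph M ConeSpace)
    (x : ConeSpace) : ConeSpace [⋀^Fin 2]→L[ℝ] ℝ :=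
  (Ω (e.symm x)).compContinuousLinearMap
    (mfderiv 𝓘(ℝ, ConeSpace) 𝓘(ℝ, ConeSpace) e.symm x)

/-- A Kähler structure on a smooth manifold of real dimension four: a complex structure `J`, a
smooth Riemannian metric `g` for which `J` is orthogonal, such that the fundamental form
`Ω(u, v) = g(J u, v)` is smooth and closed. -/
structure KahlerStructure (M : Type) [TopologicalSpace M] [ChartedSpace ConeSpace M]
    [IsManifold 𝓘(ℝ, ConeSpace) ∞ M] where
  /-- the complex structure -/
  J : ∀ p : M, Tan p →L[ℝ] Tan p
  /-- the Kähler metric -/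
  metric : Bundle.ContMDiffRiemannianMetric 𝓘(ℝ, ConeSpace) ∞ ConeSpace (fun p : M => Tan p)
  /-- the fundamental form -/
  form : ∀ p : M, Tan p [⋀^Fin 2]→L[ℝ] ℝ
  J_sq : ∀ (p : M) (v : Tan p), J p (J p v) = -v
  /-- `J` is induced by a complex manifold structure: around every point there are smooth
  coordinates with values in `ℂ²` whose differential intertwines `J` and multiplication by `i`. -/
  holomorphic_coordinates : ∀ p : M, ∃ ψ : OpenPartialHomeomorph M (ℂ × ℂ), p ∈ ψ.source ∧
    ContMDiffOn 𝓘(ℝ, ConeSpace) 𝓘(ℝ, ℂ × ℂ) ∞ ψ ψ.source ∧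
    ContMDiffOn 𝓘(ℝ, ℂ × ℂ) 𝓘(ℝ, ConeSpace) ∞ ψ.symm ψ.target ∧
    ∀ q ∈ ψ.source, ∀ v : Tan q,
      mfderiv 𝓘(ℝ, ConeSpace) 𝓘(ℝ, ℂ × ℂ) ψ q (J q v) =
        mulI (mfderiv 𝓘(ℝ, ConeSpace) 𝓘(ℝ, ℂ × ℂ) ψ q v)
  hermitian : ∀ (p : M) (u v : Tan p), metric.inner p (J p u) (J p v) = metric.inner p u v
  form_eq : ∀ (p : M) (u v : Tan p), form p ![u, v] = metric.inner p (J p u) v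
  form_smooth : ∀ e ∈ atlas ConeSpace M, ContDiffOn ℝ ∞ (chartForm form e) e.target
  form_closed : ∀ e ∈ atlas ConeSpace M, ∀ x ∈ e.target, extDeriv (chartForm form e) x = 0

/-- `f` is an isomorphism of Kähler manifolds: a diffeomorphism which respects the complex
structures, the metrics and the fundamental forms. -/
structure IsKahlerIso {M N : Type} [TopologicalSpace M] [ChartedSpace ConeSpace M]
    [IsManifold 𝓘(ℝ, ConeSpace) ∞ M] [TopologicalSpace N] [ChartedSpace ConeSpace N]
    [IsManifold 𝓘(ℝ, ConeSpace) ∞ N] (K : KahlerStructure M) (L : KahlerStructure N)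
    (f : M → N) : Prop where
  diffeo : ∃ F : M ≃ₘ^∞⟮𝓘(ℝ, ConeSpace), 𝓘(ℝ, ConeSpace)⟯ N, ⇑F = f
  map_J : ∀ (p : M) (v : Tan p),
    mfderiv 𝓘(ℝ, ConeSpace) 𝓘(ℝ, ConeSpace) f p (K.J p v) =
      L.J (f p) (mfderiv 𝓘(ℝ, ConeSpace) 𝓘(ℝ, ConeSpace) f p v)
  map_metric : ∀ (p : M) (u v : Tan p),
    L.metric.inner (f p) (mfderiv 𝓘(ℝ, ConeSpace) 𝓘(ℝ, ConeSpace) f p u)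
      (mfderiv 𝓘(ℝ, ConeSpace) 𝓘(ℝ, ConeSpace) f p v) = K.metric.inner p u v
  map_form : ∀ p : M, (L.form (f p)).compContinuousLinearMap
    (mfderiv 𝓘(ℝ, ConeSpace) 𝓘(ℝ, ConeSpace) f p) = K.form p

/-- `K` is the Kähler structure on an open subset of the cone given by the cone metric, `𝕁` and
`Ω`. The tangent spaces of an open subset `U` of `ConeSpace` are `ConeSpace` itself, the
preferred charts of `U` being restrictions of the identity. -/
def IsConeStructure (U : TopologicalSpace.Opens ConeSpace) (K : KahlerStructure U) : Prop :=
  ∀ q : U, K.J q = coneJ q.1 ∧ K.metric.inner q = coneMetric q.1 ∧ K.form q = coneForm q.1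

end ConfKahler

end

noncomputable section

namespace ConfKahler

/-! ### The pointwise algebra of the cone structure -/

/-! Kähler structure on the cone. In the frame X, Y, T, r∂/∂r with coordinates φ*, ψ*, ω*, dr/r, the
metric is r² times the sum of squares and 𝕁 rotates the planes (X, Y) and (r∂/∂r, T); hence 𝕁² = -1
and 𝕁 is orthogonal. Since dω* = 2 φ* ∧ ψ*, the exact form d(r²ω*/2) equals r dr ∧ ω* + r² φ* ∧ ψ*,
which is g(𝕁u, v) (`coneForm_apply`). Integrability is witnessed by the explicit global coordinates
(|z|² - it, rz), whose differential intertwines 𝕁 and i (`fderiv_coneHol_coneJ`).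

Configurations. `PU21` is transitive on pairs of distinct boundary points, so p₂ = ∞ and p₃ = 0 may
be assumed. The elements fixing both act by (z, t) ↦ (cz, |c|²t), c ≠ 0 (`exists_dilation`,
`exists_dilation_of_fixed`). The ℂ-circle through ∞ and 0 is z = 0, so p₁ and p₄ have nonzero
z-coordinate, and exactly one c brings p₁ to the form (1, tan a). Then tan a and p₄ = (z, t) are
complete invariants, and p₄ avoids the orbit of p₁ exactly when tan a ≠ t/|z|². With r = exp(tan a)
this is the condition defining `cone'`.

Transport. The set `F4''` receives its topology and its single chart from the bijection. For a
manifold all of whose charts are one global map ι, the derivative of ι is the identity, so tensors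
on the cone pull back without change (`IsGlobalChart`). -/

lemma norm_sq_eq (z : ℂ) : ‖z‖ ^ 2 = z.re ^ 2 + z.im ^ 2 := by
  rw [Complex.sq_norm, Complex.normSq_apply]; ring

lemma re_sq_add_im_sq_pos {z : ℂ} (hz : z ≠ 0) : 0 < z.re ^ 2 + z.im ^ 2 := by
  rw [← norm_sq_eq]; positivity

lemma phiStar_apply (p v : ℂ × ℝ) :
    phiStar p v = (p.1.re * v.1.re + p.1.im * v.1.im) / ‖p.1‖ ^ 2 := by
  simp only [phiStar, dx, dy, one_div, smul_apply,
    add_apply, ContinuousLinearMap.comp_apply, ContinuousLinearMap.coe_fst',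
    Complex.reCLM_apply, Complex.imCLM_apply, smul_eq_mul, mul_inv]
  ring

lemma psiStar_apply (p v : ℂ × ℝ) : psiStar p v = -v.2 / (2 * ‖p.1‖ ^ 2) := by
  simp only [psiStar, dt, one_div, smul_apply, ContinuousLinearMap.coe_snd',
    smul_eq_mul]
  ring

lemma omegaStar_apply (p v : ℂ × ℝ) :
    omegaStar p v = (v.2 + 2 * p.1.re * v.1.im - 2 * p.1.im * v.1.re) / (2 * ‖p.1‖ ^ 2) := by
  simp only [omegaStar, dx, dy, dt, one_div, smul_apply,
    add_apply, sub_apply, ContinuousLinearMap.comp_apply,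
    ContinuousLinearMap.coe_fst', ContinuousLinearMap.coe_snd', Complex.reCLM_apply,
    Complex.imCLM_apply, smul_eq_mul]
  ring

lemma coneMetric_apply (q u v : ConeSpace) :
    coneMetric q u v = u.2 * v.2 + q.2 ^ 2 * (phiStar q.1 u.1 * phiStar q.1 v.1 +
      psiStar q.1 u.1 * psiStar q.1 v.1 + omegaStar q.1 u.1 * omegaStar q.1 v.1) := by
  simp [coneMetric, gStar]

lemma coneJ_fst (q v : ConeSpace) :
    (coneJ q v).1 = phiStar q.1 v.1 • fieldY q.1 - psiStar q.1 v.1 • fieldX q.1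
      + (q.2⁻¹ * v.2) • fieldT q.1 := by
  simp [coneJ, PhiStar]

lemma coneJ_snd (q v : ConeSpace) : (coneJ q v).2 = -(q.2 * omegaStar q.1 v.1) := by
  simp [coneJ]

section Frame

variable {p : ℂ × ℝ}

lemma phiStar_fieldX (hp : p.1 ≠ 0) : phiStar p (fieldX p) = 1 := by
  have := (re_sq_add_im_sq_pos hp).ne'
  simp only [phiStar_apply, fieldX, norm_sq_eq]; field_simp

lemma phiStar_fieldY : phiStar p (fieldY p) = 0 := by
  simp [phiStar_apply, fieldY]; left; ring

lemma phiStar_fieldT : phiStar p (fieldT p) = 0 := by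
  simp [phiStar_apply, fieldT]; left; ring

lemma psiStar_fieldX : psiStar p (fieldX p) = 0 := by simp [psiStar_apply, fieldX]

lemma psiStar_fieldY (hp : p.1 ≠ 0) : psiStar p (fieldY p) = 1 := by
  have := (re_sq_add_im_sq_pos hp).ne'
  simp only [psiStar_apply, fieldY, norm_sq_eq]; field_simp

lemma psiStar_fieldT : psiStar p (fieldT p) = 0 := by simp [psiStar_apply, fieldT]

lemma omegaStar_fieldX : omegaStar p (fieldX p) = 0 := by
  simp [omegaStar_apply, fieldX]; left; ring

lemma omegaStar_fieldY : omegaStar p (fieldY p) = 0 := by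
  simp [omegaStar_apply, fieldY, norm_sq_eq]; left; ring

lemma omegaStar_fieldT (hp : p.1 ≠ 0) : omegaStar p (fieldT p) = 1 := by
  have := (re_sq_add_im_sq_pos hp).ne'
  simp [omegaStar_apply, fieldT, norm_sq_eq]; field_simp

/-- Duality of frame and coframe: equality of vectors can be tested on the three forms. -/
lemma frame_decomposition (hp : p.1 ≠ 0) (v : ℂ × ℝ) :
    phiStar p v • fieldX p + psiStar p v • fieldY p + omegaStar p v • fieldT p = v := by
  have := (re_sq_add_im_sq_pos hp).ne'
  simp only [phiStar_apply, psiStar_apply, omegaStar_apply, fieldX, fieldY, fieldT, norm_sq_eq]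
  refine Prod.ext (Complex.ext ?_ ?_) ?_ <;>
    simp only [Prod.fst_add, Prod.snd_add, Prod.smul_fst, Prod.smul_snd, Complex.add_re,
      Complex.add_im, Complex.smul_re, Complex.smul_im, Complex.mul_re, Complex.mul_im,
      Complex.I_re, Complex.I_im, smul_eq_mul] <;>
    field_simp <;> ring

end Frame

section

variable {q : ConeSpace}

/-- With its two companions and `coneJ_snd`, this gives 𝕁 in the coframe: (φ, ψ) ↦ (-ψ, φ) and (ω,
dr/r) ↦ (dr/r, -ω). The rest of the pointwise algebra uses only these rules. -/
lemma phiStar_coneJ (hz : q.1.1 ≠ 0) (v : ConeSpace) :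
    phiStar q.1 (coneJ q v).1 = -psiStar q.1 v.1 := by
  simp [coneJ_fst, phiStar_fieldX hz, phiStar_fieldY, phiStar_fieldT]

lemma psiStar_coneJ (hz : q.1.1 ≠ 0) (v : ConeSpace) :
    psiStar q.1 (coneJ q v).1 = phiStar q.1 v.1 := by
  simp [coneJ_fst, psiStar_fieldX, psiStar_fieldY hz, psiStar_fieldT]

lemma omegaStar_coneJ (hz : q.1.1 ≠ 0) (v : ConeSpace) :
    omegaStar q.1 (coneJ q v).1 = q.2⁻¹ * v.2 := by
  simp [coneJ_fst, omegaStar_fieldX, omegaStar_fieldY, omegaStar_fieldT hz]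

lemma coneJ_coneJ (hq : q ∈ cone) (v : ConeSpace) : coneJ q (coneJ q v) = -v := by
  have hz : q.1.1 ≠ 0 := hq.1
  have hr : q.2 ≠ 0 := ne_of_gt hq.2
  refine Prod.ext ?_ ?_
  · rw [coneJ_fst, phiStar_coneJ hz, psiStar_coneJ hz, coneJ_snd, Prod.fst_neg]
    conv_rhs => rw [← frame_decomposition hz v.1]
    rw [mul_neg, inv_mul_cancel_left₀ hr]
    module
  · rw [coneJ_snd, omegaStar_coneJ hz, mul_inv_cancel_left₀ hr, Prod.snd_neg]

lemma coneMetric_coneJ (hq : q ∈ cone) (u v : ConeSpace) :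
    coneMetric q (coneJ q u) (coneJ q v) = coneMetric q u v := by
  have hz : q.1.1 ≠ 0 := hq.1
  have hr : q.2 ≠ 0 := ne_of_gt hq.2
  simp only [coneMetric_apply, phiStar_coneJ hz, psiStar_coneJ hz, omegaStar_coneJ hz, coneJ_snd]
  field_simp
  ring

lemma coneMetric_symm (q u v : ConeSpace) : coneMetric q u v = coneMetric q v u := by
  simp only [coneMetric_apply]; ring

lemma coneMetric_pos (hq : q ∈ cone) {v : ConeSpace} (hv : v ≠ 0) : 0 < coneMetric q v v := by
  have hz : q.1.1 ≠ 0 := hq.1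
  have hr : 0 < q.2 := hq.2
  rw [coneMetric_apply]
  by_contra! h
  have hr2 : 0 < q.2 ^ 2 := by positivity
  set A := phiStar q.1 v.1 with hA
  set B := psiStar q.1 v.1 with hB
  set C := omegaStar q.1 v.1 with hC
  have h2 : v.2 = 0 := by
    have : 0 ≤ q.2 ^ 2 * (A * A + B * B + C * C) := by
      have := mul_self_nonneg A; have := mul_self_nonneg B; have := mul_self_nonneg C
      positivity
    exact mul_self_eq_zero.1 (le_antisymm (by linarith) (mul_self_nonneg _))
  have h3 : A * A + B * B + C * C ≤ 0 := by
    rw [h2] at h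
    by_contra! h'
    have := mul_pos hr2 h'
    linarith
  have hA0 : A = 0 := by
    have := mul_self_nonneg A; have := mul_self_nonneg B; have := mul_self_nonneg C
    exact mul_self_eq_zero.1 (by linarith)
  have hB0 : B = 0 := by
    have := mul_self_nonneg A; have := mul_self_nonneg B; have := mul_self_nonneg C
    exact mul_self_eq_zero.1 (by linarith)
  have hC0 : C = 0 := by
    have := mul_self_nonneg A; have := mul_self_nonneg B; have := mul_self_nonneg C
    exact mul_self_eq_zero.1 (by linarith)
  apply hv
  refine Prod.ext ?_ h2
  rw [← frame_decomposition hz v.1, ← hA, ← hB, ← hC, hA0, hB0, hC0]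
  simp

/-- Boundedness of unit balls is part of the data of a Riemannian metric on a bundle. Coframe
components of such a vector are at most 1/r and its radial component at most 1; the frame
decomposition turns this into a norm bound. -/
lemma isBounded_coneMetric_ball (hq : q ∈ cone) :
    Bornology.IsBounded {v : ConeSpace | coneMetric q v v < 1} := by
  have hz : q.1.1 ≠ 0 := hq.1
  have hr : 0 < q.2 := hq.2
  have key : ∀ {a : ℝ}, q.2 ^ 2 * (a * a) ≤ 1 → |a| ≤ q.2⁻¹ := by
    intro a ha
    have : |q.2 * a| ≤ 1 := by
      rw [← sq_le_one_iff_abs_le_one]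
      calc (q.2 * a) ^ 2 = q.2 ^ 2 * (a * a) := by ring
        _ ≤ 1 := ha
    rw [abs_mul, abs_of_pos hr] at this
    rw [inv_eq_one_div, le_div_iff₀ hr]
    linarith
  refine (Metric.isBounded_closedBall (x := (0 : ConeSpace))
    (r := max (q.2⁻¹ * ‖fieldX q.1‖ + q.2⁻¹ * ‖fieldY q.1‖ + q.2⁻¹ * ‖fieldT q.1‖) 1)).subset ?_
  intro v hv
  rw [Set.mem_ofPred_eq, coneMetric_apply] at hv
  have h1 : 0 ≤ v.2 * v.2 := mul_self_nonneg _
  have hA : 0 ≤ q.2 ^ 2 * (phiStar q.1 v.1 * phiStar q.1 v.1) :=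
    mul_nonneg (by positivity) (mul_self_nonneg _)
  have hB : 0 ≤ q.2 ^ 2 * (psiStar q.1 v.1 * psiStar q.1 v.1) :=
    mul_nonneg (by positivity) (mul_self_nonneg _)
  have hC : 0 ≤ q.2 ^ 2 * (omegaStar q.1 v.1 * omegaStar q.1 v.1) :=
    mul_nonneg (by positivity) (mul_self_nonneg _)
  rw [mem_closedBall_zero_iff, Prod.norm_def]
  refine max_le_max ?_ ?_
  · conv_lhs => rw [← frame_decomposition hz v.1]
    refine (norm_add₃_le).trans ?_
    simp only [norm_smul, Real.norm_eq_abs]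
    gcongr <;> exact key (by linarith)
  · rw [Real.norm_eq_abs, ← sq_le_one_iff_abs_le_one]
    nlinarith

end

/-! ### Smoothness, the fundamental form and holomorphic coordinates -/

lemma contDiff_fst_re : ContDiff ℝ ∞ (fun q : ConeSpace => q.1.1.re) :=
  Complex.reCLM.contDiff.comp (contDiff_fst.comp contDiff_fst)

lemma contDiff_fst_im : ContDiff ℝ ∞ (fun q : ConeSpace => q.1.1.im) :=
  Complex.imCLM.contDiff.comp (contDiff_fst.comp contDiff_fst)

lemma contDiffOn_inv_norm_sq :
    ContDiffOn ℝ ∞ (fun q : ConeSpace => 1 / (2 * ‖q.1.1‖ ^ 2)) cone := by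
  refine contDiffOn_const.div ?_ ?_
  · simp_rw [norm_sq_eq]
    exact (contDiff_const.mul ((contDiff_fst_re.pow 2).add (contDiff_fst_im.pow 2))).contDiffOn
  · intro q hq
    have : q.1.1 ≠ 0 := hq.1
    positivity

lemma contDiffOn_phiStar : ContDiffOn ℝ ∞ (fun q : ConeSpace => phiStar q.1) cone :=
  contDiffOn_inv_norm_sq.smul (((contDiff_const.mul contDiff_fst_re).smul contDiff_const).add
    ((contDiff_const.mul contDiff_fst_im).smul contDiff_const)).contDiffOn

lemma contDiffOn_psiStar : ContDiffOn ℝ ∞ (fun q : ConeSpace => psiStar q.1) cone :=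
  contDiffOn_inv_norm_sq.neg.smul contDiffOn_const

lemma contDiffOn_omegaStar : ContDiffOn ℝ ∞ (fun q : ConeSpace => omegaStar q.1) cone :=
  contDiffOn_inv_norm_sq.smul ((contDiff_const.add
    ((contDiff_const.mul contDiff_fst_re).smul contDiff_const)).sub
    ((contDiff_const.mul contDiff_fst_im).smul contDiff_const)).contDiffOn

/-- Writing r² α ⊗ α as (rα) ⊗ (rα) presents the metric as a sum of squares of smooth covector
fields. -/
lemma contDiffOn_coneMetric : ContDiffOn ℝ ∞ coneMetric cone := by
  have sq : ∀ {α : ConeSpace → ℂ × ℝ →L[ℝ] ℝ}, ContDiffOn ℝ ∞ α cone →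
      ContDiffOn ℝ ∞ (fun q : ConeSpace => (q.2 • (α q).comp
        (ContinuousLinearMap.fst ℝ (ℂ × ℝ) ℝ)).smulRight
          (q.2 • (α q).comp (ContinuousLinearMap.fst ℝ (ℂ × ℝ) ℝ))) cone := fun h =>
    have h' := contDiff_snd.contDiffOn.smul (h.clm_comp contDiffOn_const)
    h'.smulRight h'
  have h := ((contDiffOn_const (c := (ContinuousLinearMap.snd ℝ (ℂ × ℝ) ℝ).smulRight
    (ContinuousLinearMap.snd ℝ (ℂ × ℝ) ℝ))).add (sq contDiffOn_phiStar)).add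
      ((sq contDiffOn_psiStar).add (sq contDiffOn_omegaStar))
  refine h.congr fun q _ => ?_
  refine ContinuousLinearMap.ext fun u => ContinuousLinearMap.ext fun v => ?_
  rw [coneMetric_apply]
  simp
  ring

/-- The primitive `r² ω* / 2` of the fundamental form. -/
def conePrimitive (q : ConeSpace) : ConeSpace [⋀^Fin 1]→L[ℝ] ℝ :=
  ContinuousAlternatingMap.ofSubsingleton ℝ ConeSpace ℝ (0 : Fin 1)
    ((q.2 ^ 2 / 2) • (omegaStar q.1).comp (ContinuousLinearMap.fst ℝ (ℂ × ℝ) ℝ))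

lemma coneForm_eq_extDeriv : coneForm = extDeriv conePrimitive := rfl

lemma conePrimitive_apply (q : ConeSpace) (v : Fin 1 → ConeSpace) :
    conePrimitive q v = q.2 ^ 2 / 2 * omegaStar q.1 (v 0).1 := by
  simp [conePrimitive]

lemma contDiffOn_conePrimitive : ContDiffOn ℝ ∞ conePrimitive cone := by
  have h : ContDiffOn ℝ ∞ (fun q : ConeSpace =>
      (q.2 ^ 2 / 2) • (omegaStar q.1).comp (ContinuousLinearMap.fst ℝ (ℂ × ℝ) ℝ)) cone :=
    ((contDiff_snd.pow 2).div_const 2).contDiffOn.smul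
      (contDiffOn_omegaStar.clm_comp contDiffOn_const)
  exact (ContinuousAlternatingMap.ofSubsingletonLIE (𝕜 := ℝ) (E := ConeSpace) (F := ℝ)
    (0 : Fin 1)).contDiff.comp_contDiffOn h

lemma contDiffOn_coneForm : ContDiffOn ℝ ∞ coneForm cone := by
  have h := contDiffOn_conePrimitive.fderiv_of_isOpen cone.isOpen (m := ∞) (by simp)
  exact (ContinuousAlternatingMap.alternatizeUncurryFinCLM ℝ ConeSpace ℝ).contDiff.comp_contDiffOn h

lemma extDeriv_coneForm {q : ConeSpace} (hq : q ∈ cone) : extDeriv coneForm q = 0 := by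
  rw [coneForm_eq_extDeriv]
  exact extDeriv_extDeriv_apply (contDiffOn_conePrimitive.contDiffAt (cone.isOpen.mem_nhds hq))
    (by simpa using WithTop.coe_le_coe.2 (le_top : (2 : ℕ∞) ≤ ⊤))

/-- Product and quotient rule with v frozen. The last term comes from the denominator 2|z|², whose
logarithmic derivative is 2φ*. -/
lemma fderiv_conePrimitive {q : ConeSpace} (hq : q ∈ cone) (u v : ConeSpace) :
    fderiv ℝ (fun q' : ConeSpace => q'.2 ^ 2 / 2 * omegaStar q'.1 v.1) q u =
      q.2 * u.2 * omegaStar q.1 v.1 + q.2 ^ 2 * ((u.1.1.re * v.1.1.im - u.1.1.im * v.1.1.re) /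
        (2 * ‖q.1.1‖ ^ 2) - omegaStar q.1 v.1 * phiStar q.1 u.1) := by
  have hz := (re_sq_add_im_sq_pos hq.1).ne'
  have hr : HasFDerivAt (fun q : ConeSpace => q.2) (ContinuousLinearMap.snd ℝ (ℂ × ℝ) ℝ) q :=
    hasFDerivAt_snd
  have hx : HasFDerivAt (fun q : ConeSpace => q.1.1.re) (dx.comp
      (ContinuousLinearMap.fst ℝ (ℂ × ℝ) ℝ)) q :=
    (dx.comp (ContinuousLinearMap.fst ℝ (ℂ × ℝ) ℝ)).hasFDerivAt
  have hy : HasFDerivAt (fun q : ConeSpace => q.1.1.im) (dy.comp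
      (ContinuousLinearMap.fst ℝ (ℂ × ℝ) ℝ)) q :=
    (dy.comp (ContinuousLinearMap.fst ℝ (ℂ × ℝ) ℝ)).hasFDerivAt
  simp only [omegaStar_apply, phiStar_apply, norm_sq_eq]
  have hN := (((hx.const_mul 2).mul_const v.1.1.im).const_add v.1.2).sub
    ((hy.const_mul 2).mul_const v.1.1.re)
  have hD := ((hx.pow 2).add (hy.pow 2)).const_mul 2
  have hne : 2 * (q.1.1.re ^ 2 + q.1.1.im ^ 2) ≠ 0 := by positivity
  have hinv := (hasDerivAt_inv hne).comp_hasFDerivAt q hD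
  have := ((hr.pow 2).mul_const (2⁻¹ : ℝ)).mul (hN.mul hinv)
  rw [HasFDerivAt.fderiv (f' := _) (this.congr_of_eventuallyEq (.of_forall fun q' => ?_))]
  · simp [dx, dy]
    field_simp
    ring
  · simp [div_eq_mul_inv]

/-- For constant fields dη(u, v) = u(η(v)) - v(η(u)), with no bracket term. Both sides equal r dr ∧
ω* + r² φ* ∧ ψ*. -/
lemma coneForm_apply {q : ConeSpace} (hq : q ∈ cone) (u v : ConeSpace) :
    coneForm q ![u, v] = coneMetric q (coneJ q u) v := by
  have hz : q.1.1 ≠ 0 := hq.1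
  have hz' := (re_sq_add_im_sq_pos hz).ne'
  have hr : q.2 ≠ 0 := ne_of_gt hq.2
  have hd : DifferentiableAt ℝ conePrimitive q :=
    (contDiffOn_conePrimitive.contDiffAt (cone.isOpen.mem_nhds hq)).differentiableAt (by simp)
  rw [coneForm_eq_extDeriv, extDeriv_apply hd, Fin.sum_univ_two]
  simp only [conePrimitive_apply]
  have h0 : (Fin.removeNth 0 ![u, v] : Fin 1 → ConeSpace) 0 = v := rfl
  have h1 : (Fin.removeNth 1 ![u, v] : Fin 1 → ConeSpace) 0 = u := rfl
  rw [h0, h1]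
  simp only [Matrix.cons_val_zero, Matrix.cons_val_one, fderiv_conePrimitive hq]
  rw [coneMetric_apply, phiStar_coneJ hz, psiStar_coneJ hz, omegaStar_coneJ hz, coneJ_snd]
  simp only [omegaStar_apply, phiStar_apply, psiStar_apply, norm_sq_eq]
  simp
  field_simp
  ring

/-- The global holomorphic coordinates `(|z|² - i t, r z)` of the cone. -/
def coneHol (q : ConeSpace) : ℂ × ℂ :=
  (((‖q.1.1‖ ^ 2 : ℝ) : ℂ) - Complex.I * (q.1.2 : ℂ), (q.2 : ℂ) * q.1.1)

/-- The inverse of `coneHol`. -/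
def coneHolInv (w : ℂ × ℂ) : ConeSpace :=
  ((((√w.1.re / ‖w.2‖ : ℝ) : ℂ) * w.2, -w.1.im), ‖w.2‖ / √w.1.re)

/-- The image of `coneHol`. -/
def coneHolTarget : Set (ℂ × ℂ) := {w | 0 < w.1.re ∧ w.2 ≠ 0}

lemma isOpen_coneHolTarget : IsOpen coneHolTarget :=
  (isOpen_lt continuous_const (Complex.continuous_re.comp continuous_fst)).inter
    (isOpen_ne_fun continuous_snd continuous_const)

lemma contDiff_coneHol : ContDiff ℝ ∞ coneHol := by
  have h1 : ContDiff ℝ ∞ (fun q : ConeSpace => ‖q.1.1‖ ^ 2) := by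
    simp_rw [norm_sq_eq]; exact (contDiff_fst_re.pow 2).add (contDiff_fst_im.pow 2)
  refine ContDiff.prodMk ?_ ?_
  · exact (Complex.ofRealCLM.contDiff.comp h1).sub
      (contDiff_const.mul (Complex.ofRealCLM.contDiff.comp contDiff_fst.snd))
  · exact (Complex.ofRealCLM.contDiff.comp contDiff_snd).mul contDiff_fst.fst

lemma contDiffOn_coneHolInv : ContDiffOn ℝ ∞ coneHolInv coneHolTarget := by
  have hre : ContDiff ℝ ∞ (fun w : ℂ × ℂ => w.1.re) := Complex.reCLM.contDiff.comp contDiff_fst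
  have him : ContDiff ℝ ∞ (fun w : ℂ × ℂ => w.1.im) := Complex.imCLM.contDiff.comp contDiff_fst
  have hsqrt : ContDiffOn ℝ ∞ (fun w : ℂ × ℂ => √w.1.re) coneHolTarget :=
    hre.contDiffOn.sqrt fun w hw => hw.1.ne'
  have hnorm : ContDiffOn ℝ ∞ (fun w : ℂ × ℂ => ‖w.2‖) coneHolTarget :=
    contDiff_snd.contDiffOn.norm ℝ fun w hw => hw.2
  refine ContDiffOn.prodMk (ContDiffOn.prodMk ?_ him.neg.contDiffOn) ?_
  · exact (Complex.ofRealCLM.contDiff.comp_contDiffOn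
      (hsqrt.div hnorm fun w hw => norm_ne_zero_iff.2 hw.2)).mul contDiff_snd.contDiffOn
  · exact hnorm.div hsqrt fun w hw => (Real.sqrt_pos.2 hw.1).ne'

/-- The holomorphic coordinates of the cone, as a local homeomorphism. -/
def coneHolHomeo : OpenPartialHomeomorph ConeSpace (ℂ × ℂ) where
  toFun := coneHol
  invFun := coneHolInv
  source := cone
  target := coneHolTarget
  map_source' q hq := by
    have hz : q.1.1 ≠ 0 := hq.1
    have hr : q.2 ≠ 0 := ne_of_gt hq.2
    refine ⟨?_, mul_ne_zero (Complex.ofReal_ne_zero.2 hr) hz⟩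
    simp only [coneHol, Complex.sub_re, Complex.ofReal_re, Complex.mul_re, Complex.I_re,
      Complex.I_im, Complex.ofReal_im]
    simpa using pow_pos (norm_pos_iff.2 hz) 2
  map_target' w hw := by
    have h1 := Real.sqrt_pos.2 hw.1
    have h2 := norm_pos_iff.2 hw.2
    exact ⟨mul_ne_zero (Complex.ofReal_ne_zero.2 (by positivity)) hw.2, div_pos h2 h1⟩
  left_inv' q hq := by
    have hz : ‖q.1.1‖ ≠ 0 := norm_ne_zero_iff.2 hq.1
    have hz' : (‖q.1.1‖ : ℂ) ≠ 0 := Complex.ofReal_ne_zero.2 hz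
    have hr : 0 < q.2 := hq.2
    have hr' : (q.2 : ℂ) ≠ 0 := Complex.ofReal_ne_zero.2 hr.ne'
    have e1 : (coneHol q).1.re = ‖q.1.1‖ ^ 2 := by
      simp [coneHol, -Complex.ofReal_pow]
    have e2 : (coneHol q).1.im = -q.1.2 := by simp [coneHol, -Complex.ofReal_pow]
    have e3 : ‖(coneHol q).2‖ = q.2 * ‖q.1.1‖ := by simp [coneHol, abs_of_pos hr]
    have e4 : (coneHol q).2 = q.2 * q.1.1 := rfl
    -- From w = (|z|² - it, rz) one recovers |z| = √(Re w₁) and r = |w₂|/|z|.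
    rw [coneHolInv, e1, e2, e3, e4, Real.sqrt_sq (norm_nonneg _), neg_neg]
    refine Prod.ext (Prod.ext ?_ rfl) ?_
    · push_cast; field_simp
    · field_simp
  right_inv' w hw := by
    have h1 := Real.sqrt_pos.2 hw.1
    have h2 := norm_pos_iff.2 hw.2
    have h1' : ((√w.1.re : ℝ) : ℂ) ≠ 0 := Complex.ofReal_ne_zero.2 h1.ne'
    have h2' : (‖w.2‖ : ℂ) ≠ 0 := Complex.ofReal_ne_zero.2 h2.ne'
    refine Prod.ext ?_ ?_
    · have e : ‖((√w.1.re / ‖w.2‖ : ℝ) : ℂ) * w.2‖ ^ 2 = w.1.re := by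
        rw [norm_mul, Complex.norm_real, Real.norm_of_nonneg (by positivity),
          div_mul_cancel₀ _ h2.ne', Real.sq_sqrt hw.1.le]
      simp only [coneHol, coneHolInv, e]
      apply Complex.ext <;> simp
    · simp only [coneHol, coneHolInv]
      push_cast; field_simp
  open_source := cone.isOpen
  open_target := isOpen_coneHolTarget
  continuousOn_toFun := contDiff_coneHol.continuous.continuousOn
  continuousOn_invFun := contDiffOn_coneHolInv.continuousOn

lemma fderiv_coneHol (q v : ConeSpace) :
    fderiv ℝ coneHol q v =
      (((2 * (q.1.1.re * v.1.1.re + q.1.1.im * v.1.1.im) : ℝ) : ℂ) - Complex.I * (v.1.2 : ℂ),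
        (v.2 : ℂ) * q.1.1 + (q.2 : ℂ) * v.1.1) := by
  have hr : HasFDerivAt (fun q : ConeSpace => (q.2 : ℂ)) (Complex.ofRealCLM.comp
      (ContinuousLinearMap.snd ℝ (ℂ × ℝ) ℝ)) q :=
    (Complex.ofRealCLM.comp (ContinuousLinearMap.snd ℝ (ℂ × ℝ) ℝ)).hasFDerivAt
  have ht : HasFDerivAt (fun q : ConeSpace => (q.1.2 : ℂ)) (Complex.ofRealCLM.comp
      (dt.comp (ContinuousLinearMap.fst ℝ (ℂ × ℝ) ℝ))) q :=
    (Complex.ofRealCLM.comp (dt.comp (ContinuousLinearMap.fst ℝ (ℂ × ℝ) ℝ))).hasFDerivAt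
  have hz : HasFDerivAt (fun q : ConeSpace => q.1.1) ((ContinuousLinearMap.fst ℝ ℂ ℝ).comp
      (ContinuousLinearMap.fst ℝ (ℂ × ℝ) ℝ)) q :=
    ((ContinuousLinearMap.fst ℝ ℂ ℝ).comp (ContinuousLinearMap.fst ℝ (ℂ × ℝ) ℝ)).hasFDerivAt
  have h := ((Complex.ofRealCLM.hasFDerivAt.comp q hz.norm_sq).sub (ht.const_mul Complex.I)).prodMk
    (hr.mul hz)
  rw [HasFDerivAt.fderiv (f := coneHol) h]
  refine Prod.ext ?_ ?_
  · simp [dt, Complex.inner]; ring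
  · simp; ring

/-- The differential sends X to (2|z|², rz), Y to i times that, r∂/∂r to (0, rz) and T to (0, irz).
The check is done in real coordinates. -/
lemma fderiv_coneHol_coneJ {q : ConeSpace} (hq : q ∈ cone) (v : ConeSpace) :
    fderiv ℝ coneHol q (coneJ q v) = mulI (fderiv ℝ coneHol q v) := by
  have hz := (re_sq_add_im_sq_pos hq.1).ne'
  have hr : q.2 ≠ 0 := ne_of_gt hq.2
  simp only [fderiv_coneHol, coneJ_fst, coneJ_snd, phiStar_apply, psiStar_apply, omegaStar_apply,
    norm_sq_eq, fieldX, fieldY, fieldT, mulI]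
  refine Prod.ext (Complex.ext ?_ ?_) (Complex.ext ?_ ?_) <;>
    simp only [Prod.fst_add, Prod.snd_add, Prod.fst_sub, Prod.snd_sub, Prod.smul_fst, Prod.smul_snd,
      Complex.add_re, Complex.add_im, Complex.sub_re, Complex.sub_im, Complex.smul_re,
      Complex.smul_im, Complex.mul_re, Complex.mul_im, Complex.I_re, Complex.I_im,
      Complex.ofReal_re, Complex.ofReal_im, smul_eq_mul, ContinuousLinearMap.coe_restrictScalars',
      FunLike.coe_smul, Pi.smul_apply, ContinuousLinearMap.coe_id', id_eq] <;>
    field_simp <;> ring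

/-! ### Manifolds whose atlas is given by an open embedding into the model space -/

section GlobalChart

open Set Filter

/-- Every chart of the atlas of `M` is the everywhere defined map `ι`. -/
structure IsGlobalChart {M : Type} [TopologicalSpace M] [ChartedSpace ConeSpace M]
    (ι : M → ConeSpace) : Prop where
  coe_eq : ∀ e ∈ atlas ConeSpace M, ⇑e = ι
  source_eq : ∀ e ∈ atlas ConeSpace M, e.source = univ

lemma isGlobalChart_opens (U : TopologicalSpace.Opens ConeSpace) :
    IsGlobalChart (fun q : U => (q : ConeSpace)) := by
  have h : ∀ e ∈ atlas ConeSpace U, ⇑e = Subtype.val ∧ e.source = univ := by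
    intro e he
    -- A chart in the atlas comes from a point of `U`, so the empty case is vacuous.
    have : Nonempty U := by
      rcases he with ⟨_, ⟨x, _⟩, _⟩
      exact ⟨x⟩
    obtain ⟨x, rfl⟩ := TopologicalSpace.Opens.chart_eq this he
    refine ⟨rfl, ?_⟩
    rw [OpenPartialHomeomorph.subtypeRestr_source]
    exact preimage_univ
  exact ⟨fun e he => (h e he).1, fun e he => (h e he).2⟩

lemma isGlobalChart_singleton {M : Type} [TopologicalSpace M] [Nonempty M] {ι : M → ConeSpace}
    (h : Topology.IsOpenEmbedding ι) :
    let _ := h.singletonChartedSpace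
    IsGlobalChart ι := by
  let _ := h.singletonChartedSpace
  refine ⟨fun e he => ?_, fun e he => ?_⟩ <;> obtain rfl : e = h.toOpenPartialHomeomorph ι := he
  · rfl
  · simp

namespace IsGlobalChart

variable {M : Type} [TopologicalSpace M] [ChartedSpace ConeSpace M] {ι : M → ConeSpace}
  (h : IsGlobalChart ι)
include h

lemma coe_chartAt (p : M) : ⇑(chartAt ConeSpace p) = ι := h.coe_eq _ (chart_mem_atlas _ p)

lemma chartAt_source (p : M) : (chartAt ConeSpace p).source = univ :=
  h.source_eq _ (chart_mem_atlas _ p)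

lemma map_symm {e : OpenPartialHomeomorph M ConeSpace} (he : e ∈ atlas ConeSpace M)
    {x : ConeSpace} (hx : x ∈ e.target) : ι (e.symm x) = x := by
  rw [← h.coe_eq e he, e.right_inv hx]

lemma symm_map {e : OpenPartialHomeomorph M ConeSpace} (he : e ∈ atlas ConeSpace M) (p : M) :
    e.symm (ι p) = p := by
  rw [← h.coe_eq e he, e.left_inv (by simp [h.source_eq e he])]

lemma map_mem_target {e : OpenPartialHomeomorph M ConeSpace} (he : e ∈ atlas ConeSpace M)
    (p : M) : ι p ∈ e.target := by
  rw [← h.coe_eq e he]; exact e.map_source (by simp [h.source_eq e he])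

/-- The preferred chart at p is ι itself, so ι read in charts is the identity near ι p. -/
lemma hasMFDerivAt (p : M) :
    HasMFDerivAt 𝓘(ℝ, ConeSpace) 𝓘(ℝ, ConeSpace) ι p (ContinuousLinearMap.id ℝ ConeSpace) := by
  refine ⟨?_, ?_⟩
  · rw [← h.coe_chartAt p]
    exact (chartAt ConeSpace p).continuousAt (mem_chart_source _ p)
  · refine ((hasFDerivAt_id _).congr_of_eventuallyEq ?_).hasFDerivWithinAt
    have : (chartAt ConeSpace p).target ∈ 𝓝 (ι p) :=
      (chartAt ConeSpace p).open_target.mem_nhds (h.map_mem_target (chart_mem_atlas _ p) p)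
    simp only [mfld_simps, h.coe_chartAt]
    filter_upwards [this] with x hx
    simp only [mfld_simps]
    exact h.map_symm (chart_mem_atlas _ p) hx

lemma mfderiv_eq (p : M) : mfderiv 𝓘(ℝ, ConeSpace) 𝓘(ℝ, ConeSpace) ι p =
    ContinuousLinearMap.id ℝ ConeSpace := (h.hasMFDerivAt p).mfderiv

lemma hasMFDerivAt_symm {e : OpenPartialHomeomorph M ConeSpace} (he : e ∈ atlas ConeSpace M)
    {x : ConeSpace} (hx : x ∈ e.target) :
    HasMFDerivAt 𝓘(ℝ, ConeSpace) 𝓘(ℝ, ConeSpace) e.symm x (ContinuousLinearMap.id ℝ ConeSpace) := by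
  refine ⟨e.symm.continuousAt hx, ?_⟩
  refine ((hasFDerivAt_id _).congr_of_eventuallyEq ?_).hasFDerivWithinAt
  filter_upwards [e.open_target.mem_nhds hx] with y hy
  simp only [writtenInExtChartAt, mfld_simps, h.coe_chartAt]
  exact h.map_symm he hy

lemma chartForm_eq {e : OpenPartialHomeomorph M ConeSpace} (he : e ∈ atlas ConeSpace M)
    {Ω : ∀ p : M, Tan p [⋀^Fin 2]→L[ℝ] ℝ} {Θ : ConeSpace → ConeSpace [⋀^Fin 2]→L[ℝ] ℝ}
    (hΩ : ∀ p, Ω p = Θ (ι p)) {x : ConeSpace} (hx : x ∈ e.target) : chartForm Ω e x = Θ x := by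
  rw [chartForm, (h.hasMFDerivAt_symm he hx).mfderiv, hΩ, h.map_symm he hx]
  ext v
  rfl

variable [IsManifold 𝓘(ℝ, ConeSpace) ∞ M]

lemma contMDiff : ContMDiff 𝓘(ℝ, ConeSpace) 𝓘(ℝ, ConeSpace) ∞ ι := by
  intro p
  rw [← h.coe_chartAt p]
  exact (contMDiffOn_chart (I := 𝓘(ℝ, ConeSpace)) (n := ∞)).contMDiffAt
    (by rw [h.chartAt_source]; exact univ_mem)

/-- All coordinate changes are the identity, hence so are the tangent trivialisations. This reduces
smoothness of the metric as a bundle section to smoothness of a map on the model space. -/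
lemma symmL_trivializationAt (p q : M) :
    (trivializationAt ConeSpace (TangentSpace 𝓘(ℝ, ConeSpace)) p).symmL ℝ q =
      ContinuousLinearMap.id ℝ ConeSpace := by
  rw [TangentBundle.symmL_trivializationAt_eq_core (by simp [h.chartAt_source])]
  rw [tangentBundleCore_coordChange]
  simp only [mfld_simps, fderivWithin_univ]
  refine HasFDerivAt.fderiv ((hasFDerivAt_id _).congr_of_eventuallyEq ?_)
  filter_upwards [(chartAt ConeSpace p).open_target.mem_nhds
    ((chartAt ConeSpace p).map_source (by simp [h.chartAt_source]))] with x hx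
  simp only [mfld_simps, h.coe_chartAt]
  exact h.map_symm (chart_mem_atlas _ p) hx

lemma contMDiff_metric {g : ∀ p : M, Tan p →L[ℝ] Tan p →L[ℝ] ℝ}
    {G : ConeSpace → ConeSpace →L[ℝ] ConeSpace →L[ℝ] ℝ} (hg : ∀ p, g p = G (ι p))
    (hG : ∀ p, ContDiffAt ℝ ∞ G (ι p)) :
    ContMDiff 𝓘(ℝ, ConeSpace) (𝓘(ℝ, ConeSpace).prod 𝓘(ℝ, ConeSpace →L[ℝ] ConeSpace →L[ℝ] ℝ)) ∞
      (fun p : M => Bundle.TotalSpace.mk' (ConeSpace →L[ℝ] ConeSpace →L[ℝ] ℝ)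
        (E := fun p : M => Tan p →L[ℝ] Tan p →L[ℝ] ℝ) p (g p)) := by
  intro p
  rw [Bundle.contMDiffAt_section]
  convert! (hG p).contMDiffAt.comp p h.contMDiff.contMDiffAt using 1
  refine funext fun q => ContinuousLinearMap.ext fun v => ContinuousLinearMap.ext fun w => ?_
  have hv : ∀ v : ConeSpace, (trivializationAt ConeSpace (TangentSpace 𝓘(ℝ, ConeSpace)) p).symm
      q v = v := fun v => by
    rw [← Bundle.Trivialization.symmL_apply (R := ℝ) _ (by simp [h.chartAt_source]),
      h.symmL_trivializationAt]
    rfl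
  rw [hom_trivializationAt_apply, inCoordinates_apply_eq₂ (by simp [h.chartAt_source])
    (by simp [h.chartAt_source]) (by simp)]
  rw [hv, hv]
  simp [hg]
  rfl

/-- The Kähler structure that the open embedding `ι` into the cone pulls back from the cone. -/
def kahlerStructure (hc : ∀ p, ι p ∈ cone) : KahlerStructure M where
  J p := coneJ (ι p)
  metric :=
    { inner := fun p => coneMetric (ι p)
      symm := fun p => coneMetric_symm (ι p)
      pos := fun p v hv => coneMetric_pos (hc p) hv
      isVonNBounded := fun p =>
        (NormedSpace.isVonNBounded_iff ℝ).2 (isBounded_coneMetric_ball (hc p))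
      contMDiff := h.contMDiff_metric (fun _ => rfl) fun p =>
        contDiffOn_coneMetric.contDiffAt (cone.isOpen.mem_nhds (hc p)) }
  form p := coneForm (ι p)
  J_sq p v := coneJ_coneJ (hc p) v
  holomorphic_coordinates p := by
    have hcoe : ⇑((chartAt ConeSpace p).trans coneHolHomeo) = coneHol ∘ ι := by
      rw [OpenPartialHomeomorph.coe_trans, h.coe_chartAt]; rfl
    refine ⟨(chartAt ConeSpace p).trans coneHolHomeo, ?_, ?_, ?_, ?_⟩
    · rw [OpenPartialHomeomorph.trans_source]
      refine ⟨mem_chart_source _ p, ?_⟩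
      rw [mem_preimage, h.coe_chartAt]
      exact hc p
    · rw [hcoe]
      exact (contDiff_coneHol.contMDiff.comp h.contMDiff).contMDiffOn
    · rw [OpenPartialHomeomorph.trans_target]
      exact (contMDiffOn_chart_symm (I := 𝓘(ℝ, ConeSpace)) (n := ∞)).comp
        (contDiffOn_coneHolInv.contMDiffOn.mono inter_subset_left) inter_subset_right
    · intro q _ v
      have hd : HasMFDerivAt 𝓘(ℝ, ConeSpace) 𝓘(ℝ, ℂ × ℂ) (coneHol ∘ ι) q
          (fderiv ℝ coneHol (ι q)) :=
        ((contDiff_coneHol.differentiable (by simp)).differentiableAt.hasFDerivAt.hasMFDerivAt).comp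
          q (h.hasMFDerivAt q)
      rw [hcoe, hd.mfderiv]
      exact fderiv_coneHol_coneJ (hc q) v
  hermitian p := coneMetric_coneJ (hc p)
  form_eq p := coneForm_apply (hc p)
  form_smooth e he := by
    have hsub : e.target ⊆ cone := fun x hx => by rw [← h.map_symm he hx]; exact hc _
    exact (contDiffOn_coneForm.mono hsub).congr fun x hx => h.chartForm_eq he (fun _ => rfl) hx
  form_closed e he x hx := by
    have hxc : x ∈ cone := by rw [← h.map_symm he hx]; exact hc _
    rw [← extDeriv_coneForm hxc]
    refine EventuallyEq.extDeriv_eq ?_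
    filter_upwards [e.open_target.mem_nhds hx] with y hy
    exact h.chartForm_eq he (fun _ => rfl) hy

/-- Since κ ∘ f = ι, the map f is the identity in the global charts, and both structures are pulled
back from the same tensors on the cone. -/
lemma isKahlerIso {N : Type} [TopologicalSpace N] [ChartedSpace ConeSpace N]
    [IsManifold 𝓘(ℝ, ConeSpace) ∞ N] {κ : N → ConeSpace} (h' : IsGlobalChart κ)
    (hc : ∀ p, ι p ∈ cone) (hc' : ∀ p, κ p ∈ cone) (f : M ≃ N) (hf : ∀ p, κ (f p) = ι p) :
    IsKahlerIso (h.kahlerStructure hc) (h'.kahlerStructure hc') f := by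
  -- Stated for arbitrary manifolds so that it serves both f and its inverse.
  have smooth : ∀ {M N : Type} [TopologicalSpace M] [ChartedSpace ConeSpace M]
      [IsManifold 𝓘(ℝ, ConeSpace) ∞ M] [TopologicalSpace N] [ChartedSpace ConeSpace N]
      [IsManifold 𝓘(ℝ, ConeSpace) ∞ N] {ι : M → ConeSpace} {κ : N → ConeSpace}
      (_ : IsGlobalChart ι) (_ : IsGlobalChart κ) (f : M → N) (_ : ∀ p, κ (f p) = ι p),
      ContMDiff 𝓘(ℝ, ConeSpace) 𝓘(ℝ, ConeSpace) ∞ f := by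
    intro M N _ _ _ _ _ _ ι κ h h' f hf p
    have e : f = (chartAt ConeSpace (f p)).symm ∘ ι := funext fun q => by
      rw [Function.comp_apply, ← hf, h'.symm_map (chart_mem_atlas _ _)]
    rw [e]
    refine ContMDiffAt.comp p (I' := 𝓘(ℝ, ConeSpace)) ?_ h.contMDiff.contMDiffAt
    refine contMDiffOn_chart_symm.contMDiffAt ((chartAt ConeSpace (f p)).open_target.mem_nhds ?_)
    rw [← hf]
    exact h'.map_mem_target (chart_mem_atlas _ _) _
  have hsymm : ∀ q, ι (f.symm q) = κ q := fun q => by rw [← hf, f.apply_symm_apply]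
  have hd : ∀ p, mfderiv 𝓘(ℝ, ConeSpace) 𝓘(ℝ, ConeSpace) f p =
      ContinuousLinearMap.id ℝ ConeSpace := fun p => by
    have h1 := ((smooth h h' f hf).mdifferentiable (by simp) p).hasMFDerivAt
    have h2 := (h'.hasMFDerivAt (f p)).comp p h1
    have e : κ ∘ f = ι := funext hf
    rw [e] at h2
    exact h2.mfderiv.symm.trans (h.mfderiv_eq p)
  refine ⟨⟨⟨f, smooth h h' f hf, smooth h' h f.symm hsymm⟩, rfl⟩, fun p v => ?_, fun p u v => ?_,
    fun p => ?_⟩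
  · rw [hd]
    change coneJ (ι p) v = coneJ (κ (f p)) v
    rw [hf]
  · rw [hd]
    change coneMetric (κ (f p)) u v = coneMetric (ι p) u v
    rw [hf]
  · rw [hd]
    ext v
    change coneForm (κ (f p)) v = coneForm (ι p) v
    rw [hf]

end IsGlobalChart

lemma isConeStructure_opens {U : TopologicalSpace.Opens ConeSpace} (hU : ∀ p : U, p.1 ∈ cone) :
    IsConeStructure U ((isGlobalChart_opens U).kahlerStructure hU) :=
  fun _ => ⟨rfl, rfl, rfl⟩

end GlobalChart

/-! ### The Hermitian form and the action of `PU(2,1)` on the boundary -/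

section Boundary

open Projectivization

lemma herm_apply (v w : C21) :
    herm v w = v 0 * star (w 2) + v 1 * star (w 1) + v 2 * star (w 0) := by
  simp [herm, hermMatrix, Matrix.mulVec, dotProduct, Fin.sum_univ_three]
  ring

lemma herm_comm (v w : C21) : herm w v = star (herm v w) := by
  simp [herm_apply]; ring

lemma herm_smul_smul (a b : ℂ) (v w : C21) : herm (a • v) (b • w) = a * star b * herm v w := by
  simp [herm_apply]; ring

lemma mk_mem_boundary {v : C21} (hv : v ≠ 0) : mk ℂ v hv ∈ boundary ↔ herm v v = 0 := by
  obtain ⟨a, ha⟩ := exists_smul_eq_mk_rep ℂ v hv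
  have : herm (mk ℂ v hv).rep (mk ℂ v hv).rep = (a : ℂ) * star (a : ℂ) * herm v v := by
    rw [← ha, ← herm_smul_smul]; rfl
  change herm _ _ = 0 ↔ _
  rw [this]
  simp

/-- Membership in `U21` thus becomes a condition on the Gram matrix of the columns. -/
lemma conjTranspose_mul_hermMatrix_mul_apply (A : Matrix (Fin 3) (Fin 3) ℂ) (i j : Fin 3) :
    (A.conjTranspose * hermMatrix * A) i j = herm (A.col j) (A.col i) := by
  simp [herm_apply, hermMatrix, Matrix.mul_apply, Fin.sum_univ_three, Matrix.col]
  ring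

lemma herm_mulVec {A : GL (Fin 3) ℂ} (hA : A ∈ U21) (v w : C21) :
    herm ((A : Matrix (Fin 3) (Fin 3) ℂ).mulVec v) ((A : Matrix (Fin 3) (Fin 3) ℂ).mulVec w) =
      herm v w := by
  have h : (A : Matrix (Fin 3) (Fin 3) ℂ).conjTranspose * hermMatrix *
    (A : Matrix (Fin 3) (Fin 3) ℂ) = hermMatrix := hA
  rw [herm, herm, Matrix.star_mulVec, ← Matrix.dotProduct_mulVec, Matrix.mulVec_mulVec,
    Matrix.mulVec_mulVec, h]

lemma exists_matrix_of_PU21 (g : PU21) :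
    ∃ A : Matrix (Fin 3) (Fin 3) ℂ, (∀ v w, herm (A.mulVec v) (A.mulVec w) = herm v w) ∧
      ∀ (v : C21) (hv : v ≠ 0), ∃ hv' : A.mulVec v ≠ 0, g • mk ℂ v hv = mk ℂ (A.mulVec v) hv' := by
  obtain ⟨g, A, hA, rfl⟩ := g
  exact ⟨A, herm_mulVec hA, fun v hv => ⟨(smul_ne_zero_iff_ne A).2 hv, rfl⟩⟩

/-- The matrix with columns u, w, v is unitary because they satisfy the pairings of the standard
basis; as H² = 1, it has left inverse H A* H. -/
lemma exists_PU21_of_frame {u w v : C21} (huu : herm u u = 0) (hvv : herm v v = 0)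
    (huv : herm u v = 1) (hww : herm w w = 1) (hwu : herm w u = 0) (hwv : herm w v = 0) :
    ∃ g : PU21, ∀ (x : C21) (hx : x ≠ 0), ∃ hy : x 0 • u + x 1 • w + x 2 • v ≠ 0,
      g • mk ℂ x hx = mk ℂ (x 0 • u + x 1 • w + x 2 • v) hy := by
  set A : Matrix (Fin 3) (Fin 3) ℂ := Matrix.of fun i j => (![u, w, v] : Fin 3 → C21) j i with hA
  have hcol : ∀ j, A.col j = (![u, w, v] : Fin 3 → C21) j := fun j => rfl
  have hAH : A.conjTranspose * hermMatrix * A = hermMatrix := by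
    have hvu : herm v u = 1 := by rw [herm_comm, huv, star_one]
    have huw : herm u w = 0 := by rw [herm_comm, hwu, star_zero]
    have hvw : herm v w = 0 := by rw [herm_comm, hwv, star_zero]
    ext i j
    rw [conjTranspose_mul_hermMatrix_mul_apply, hcol, hcol]
    fin_cases i <;> fin_cases j <;> simp [hermMatrix, huu, hvv, huv, hww, hwu, hwv, hvu, huw, hvw]
  have hH : hermMatrix * hermMatrix = 1 := by
    ext i j
    fin_cases i <;> fin_cases j <;> simp [hermMatrix, Matrix.mul_apply, Fin.sum_univ_three]
  have hinv : (hermMatrix * (A.conjTranspose * hermMatrix)) * A = 1 := by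
    rw [Matrix.mul_assoc, hAH, hH]
  have hdet : IsUnit A.det := Matrix.isUnit_det_of_left_inverse hinv
  have hmem : Matrix.GeneralLinearGroup.mk'' A hdet ∈ U21 := hAH
  have hmul : ∀ x : C21, A.mulVec x = x 0 • u + x 1 • w + x 2 • v := by
    intro x
    ext i
    simp [hA, Matrix.mulVec, dotProduct, Fin.sum_univ_three]
    ring
  refine ⟨⟨_, _, hmem, rfl⟩, fun x hx => ?_⟩
  have hne : A.mulVec x ≠ 0 :=
    (smul_ne_zero_iff_ne (Matrix.GeneralLinearGroup.mk'' A hdet)).2 hx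
  exact ⟨hmul x ▸ hne, by simp only [← hmul]; rfl⟩

lemma smul_mem_boundary (g : PU21) {p : ℙ ℂ C21} (hp : p ∈ boundary) : g • p ∈ boundary := by
  induction p using Projectivization.ind with | _ v hv
  obtain ⟨A, hA, hg⟩ := exists_matrix_of_PU21 g
  obtain ⟨hv', e⟩ := hg v hv
  rw [e, mk_mem_boundary, hA]
  exact (mk_mem_boundary hv).1 hp

lemma inftyPt_mem_boundary : inftyPt ∈ boundary := by
  rw [inftyPt, mk_mem_boundary]; simp [herm_apply]

lemma ofReal_sqrt_two_sq : ((√2 : ℝ) : ℂ) ^ 2 = 2 := by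
  rw [← Complex.ofReal_pow, Real.sq_sqrt zero_le_two]; norm_num

lemma ofReal_sqrt_two_ne_zero : ((√2 : ℝ) : ℂ) ≠ 0 := by simp

lemma heis_mem_boundary (z : ℂ) (t : ℝ) : heis z t ∈ boundary := by
  rw [heis, mk_mem_boundary, herm_apply]
  have h := Complex.mul_conj' z
  simp
  linear_combination 2 * h + z * (starRingEnd ℂ) z * ofReal_sqrt_two_sq

lemma heis_injective {z w : ℂ} {t s : ℝ} (h : heis z t = heis w s) : z = w ∧ t = s := by
  rw [heis, heis, mk_eq_mk_iff'] at h
  obtain ⟨a, ha⟩ := h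
  have h2 := congrFun ha 2
  have h1 := congrFun ha 1
  have h0 := congrFun ha 0
  simp at h0 h1 h2
  subst h2
  have hzw : z = w := by simpa using h1.symm
  subst hzw
  simpa using h0.symm

lemma heis_ne_inftyPt (z : ℂ) (t : ℝ) : heis z t ≠ inftyPt := by
  intro h
  rw [heis, inftyPt, mk_eq_mk_iff'] at h
  obtain ⟨a, ha⟩ := h
  simpa using congrFun ha 2

/-- If v₂ = 0, nullity forces v₁ = 0. Otherwise scale to v₂ = 1; nullity then fixes the real part of
the first coordinate. -/
lemma eq_inftyPt_or_heis {p : ℙ ℂ C21} (hp : p ∈ boundary) :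
    p = inftyPt ∨ ∃ z t, p = heis z t := by
  induction p using Projectivization.ind with | _ v hv
  rw [mk_mem_boundary, herm_apply] at hp
  by_cases h2 : v 2 = 0
  · left
    have h1 : v 1 = 0 := by simpa [h2] using hp
    rw [inftyPt, mk_eq_mk_iff']
    refine ⟨v 0, ?_⟩
    ext i
    fin_cases i <;> simp [h1, h2]
  · right
    refine ⟨v 1 / v 2 / √2, (v 0 / v 2).im, ?_⟩
    rw [heis, mk_eq_mk_iff']
    refine ⟨v 2, ?_⟩
    have hre : (v 0 / v 2).re = -‖v 1 / v 2 / √2‖ ^ 2 := by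
      have h2' : star (v 2) ≠ 0 := star_ne_zero.2 h2
      have e : v 0 / v 2 + star (v 0 / v 2) + v 1 / v 2 * star (v 1 / v 2) = 0 := by
        rw [star_div₀, star_div₀]
        field_simp
        linear_combination hp
      have e' := congrArg Complex.re e
      rw [Complex.star_def, Complex.mul_conj', ← Complex.ofReal_pow, Complex.add_re,
        Complex.add_re, Complex.ofReal_re, Complex.conj_re, Complex.zero_re] at e'
      rw [norm_div _ ((√2 : ℝ) : ℂ), div_pow, Complex.norm_real, Real.norm_eq_abs, sq_abs,
        Real.sq_sqrt zero_le_two]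
      linarith
    have h0 : ((-(‖v 1 / v 2 / √2‖ ^ 2 : ℝ) : ℝ) : ℂ) + Complex.I * ((v 0 / v 2).im : ℂ) =
        v 0 / v 2 := by
      rw [← hre, mul_comm]
      exact Complex.re_add_im _
    ext i
    fin_cases i
    · simp only [Fin.zero_eta, Pi.smul_apply, Matrix.cons_val_zero, smul_eq_mul]
      rw [← Complex.ofReal_neg, h0, mul_div_cancel₀ _ h2]
    · have := ofReal_sqrt_two_ne_zero
      simp
      field_simp
    · simp

/-- For two Heisenberg lifts the real part of the form is -|z - w|², and when z = w the imaginary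
part is t - s. -/
lemma herm_ne_zero_of_mem_boundary {u v : C21} (hu : u ≠ 0) (hv : v ≠ 0)
    (hub : mk ℂ u hu ∈ boundary) (hvb : mk ℂ v hv ∈ boundary) (hne : mk ℂ u hu ≠ mk ℂ v hv) :
    herm u v ≠ 0 := by
  have lift : ∀ {x y : C21} (hx : x ≠ 0) (hy : y ≠ 0), mk ℂ x hx = mk ℂ y hy →
      ∃ a : ℂ, a ≠ 0 ∧ x = a • y := fun hx hy h => by
    obtain ⟨a, ha⟩ := (mk_eq_mk_iff ℂ _ _ hx hy).1 h
    exact ⟨a, a.ne_zero, ha.symm⟩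
  rcases eq_inftyPt_or_heis hub with hu' | ⟨z, t, hu'⟩ <;>
    rcases eq_inftyPt_or_heis hvb with hv' | ⟨w, s, hv'⟩
  · exact absurd (hu'.trans hv'.symm) hne
  · obtain ⟨a, ha, rfl⟩ := lift _ _ hu'
    obtain ⟨b, hb, rfl⟩ := lift _ _ hv'
    rw [herm_smul_smul]
    simp [ha, hb, herm_apply]
  · obtain ⟨a, ha, rfl⟩ := lift _ _ hu'
    obtain ⟨b, hb, rfl⟩ := lift _ _ hv'
    rw [herm_smul_smul]
    simp [ha, hb, herm_apply]
  · have hzw : ¬ (z = w ∧ t = s) := by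
      rintro ⟨rfl, rfl⟩
      exact hne (hu'.trans hv'.symm)
    obtain ⟨a, ha, rfl⟩ := lift _ _ hu'
    obtain ⟨b, hb, rfl⟩ := lift _ _ hv'
    rw [herm_smul_smul]
    refine mul_ne_zero (mul_ne_zero ha (star_ne_zero.2 hb)) fun h => hzw ?_
    rw [herm_apply] at h
    have hs : (√2 : ℝ) * √2 = 2 := Real.mul_self_sqrt zero_le_two
    have hre := congrArg Complex.re h
    have him := congrArg Complex.im h
    simp [-Complex.ofReal_pow, norm_sq_eq] at hre him
    have hre' : (z.re - w.re) ^ 2 + (z.im - w.im) ^ 2 = 0 := by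
      linear_combination -hre + (z.re * w.re + z.im * w.im) * hs
    have h1 : z.re = w.re := by nlinarith [sq_nonneg (z.re - w.re), sq_nonneg (z.im - w.im)]
    have h2 : z.im = w.im := by nlinarith [sq_nonneg (z.re - w.re), sq_nonneg (z.im - w.im)]
    refine ⟨Complex.ext h1 h2, ?_⟩
    rw [h1, h2] at him
    linear_combination him

/-- `PU(2,1)` acts transitively on pairs of distinct boundary points. -/
lemma exists_smul_eq_inftyPt_and_heis {p q : ℙ ℂ C21} (hp : p ∈ boundary) (hq : q ∈ boundary)
    (hpq : p ≠ q) : ∃ g : PU21, g • p = inftyPt ∧ g • q = heis 0 0 := by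
  induction p using Projectivization.ind with | _ u hu
  induction q using Projectivization.ind with | _ v hv
  have huv := herm_ne_zero_of_mem_boundary hu hv hp hq hpq
  rw [mk_mem_boundary] at hp hq
  set u' : C21 := (herm u v)⁻¹ • u with hu'
  have hn : herm u' v = 1 := by
    have := herm_smul_smul (herm u v)⁻¹ 1 u v
    rw [one_smul, star_one, mul_one, inv_mul_cancel₀ huv] at this
    exact this
  have hn' : herm v u' = 1 := by rw [herm_comm, hn, star_one]
  have hu'' : herm u' u' = 0 := by rw [hu', herm_smul_smul, hp, mul_zero]
  -- The Hermitian cross product of u' and v: orthogonal to both, with ⟨w, w⟩ = |⟨u', v⟩|² - ⟨u',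
  -- u'⟩⟨v, v⟩ = 1.
  set w : C21 := ![star (u' 0 * v 1 - u' 1 * v 0), star (u' 2 * v 0 - u' 0 * v 2),
    star (u' 1 * v 2 - u' 2 * v 1)] with hw
  obtain ⟨g, hg⟩ := exists_PU21_of_frame (w := w) hu'' hq hn
    (by
      rw [herm_apply] at hn hn' hu'' hq ⊢
      simp [hw] at hn hn' hu'' hq ⊢
      linear_combination hn + hn' * (u' 0 * (starRingEnd ℂ) (v 2) +
        u' 1 * (starRingEnd ℂ) (v 1) + u' 2 * (starRingEnd ℂ) (v 0)) - hu'' * (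
          v 0 * (starRingEnd ℂ) (v 2) + v 1 * (starRingEnd ℂ) (v 1) + v 2 * (starRingEnd ℂ) (v 0)))
    (by rw [herm_apply]; simp [hw]; ring)
    (by rw [herm_apply]; simp [hw]; ring)
  refine ⟨g⁻¹, ?_, ?_⟩
  · rw [inv_smul_eq_iff, inftyPt]
    obtain ⟨hy, e⟩ := hg ![1, 0, 0] (fun h => one_ne_zero (congrFun h 0))
    rw [e, mk_eq_mk_iff']
    exact ⟨herm u v, by simp [hu', huv]⟩
  · rw [inv_smul_eq_iff, heis]
    obtain ⟨hy, e⟩ := hg ![-((‖(0 : ℂ)‖ ^ 2 : ℝ) : ℂ) + Complex.I * ((0 : ℝ) : ℂ),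
      ((√2 : ℝ) : ℂ) * 0, 1] (fun h => one_ne_zero (congrFun h 2))
    rw [e, mk_eq_mk_iff']
    exact ⟨1, by simp⟩

/-- The rotations and dilations of the Heisenberg group are elements of `PU(2,1)`. -/
lemma exists_dilation {c : ℂ} (hc : c ≠ 0) : ∃ g : PU21, g • inftyPt = inftyPt ∧
    ∀ z t, g • heis z t = heis (c * z) (‖c‖ ^ 2 * t) := by
  have hn : (‖c‖ : ℂ) ≠ 0 := by simpa using hc
  have hcc := Complex.mul_conj' c
  -- The matrix diag(|c|, c/|c|, 1/|c|) is projectively diag(|c|², c, 1).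
  obtain ⟨g, hg⟩ := exists_PU21_of_frame (u := ![(‖c‖ : ℂ), 0, 0]) (w := ![0, c / ‖c‖, 0])
    (v := ![0, 0, (‖c‖ : ℂ)⁻¹]) (by simp [herm_apply]) (by simp [herm_apply])
    (by simp [herm_apply, hn]) (by
      simp [herm_apply]; field_simp; linear_combination hcc) (by simp [herm_apply])
      (by simp [herm_apply])
  refine ⟨g, ?_, fun z t => ?_⟩
  · rw [inftyPt]
    obtain ⟨hy, e⟩ := hg ![1, 0, 0] (fun h => one_ne_zero (congrFun h 0))
    rw [e, mk_eq_mk_iff']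
    exact ⟨‖c‖, by simp⟩
  · rw [heis, heis]
    obtain ⟨hy, e⟩ := hg ![-((‖z‖ ^ 2 : ℝ) : ℂ) + Complex.I * (t : ℂ),
      ((√2 : ℝ) : ℂ) * z, 1] (fun h => one_ne_zero (congrFun h 2))
    rw [e, mk_eq_mk_iff']
    refine ⟨(‖c‖ : ℂ)⁻¹, ?_⟩
    ext i
    fin_cases i <;> simp <;> field_simp

/-- An element of `PU(2,1)` which fixes `∞` and `0` is a rotation followed by a dilation. -/
lemma exists_dilation_of_fixed {g : PU21} (h1 : g • inftyPt = inftyPt)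
    (h2 : g • heis 0 0 = heis 0 0) :
    ∃ c : ℂ, c ≠ 0 ∧ ∀ z t, g • heis z t = heis (c * z) (‖c‖ ^ 2 * t) := by
  obtain ⟨A, hA, hg⟩ := exists_matrix_of_PU21 g
  obtain ⟨k1, e1⟩ := hg ![1, 0, 0] (fun h => one_ne_zero (congrFun h 0))
  obtain ⟨k2, e2⟩ := hg ![-((‖(0 : ℂ)‖ ^ 2 : ℝ) : ℂ) + Complex.I * ((0 : ℝ) : ℂ),
      ((√2 : ℝ) : ℂ) * 0, 1] (fun h => one_ne_zero (congrFun h 2))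
  rw [inftyPt, e1, mk_eq_mk_iff'] at h1
  rw [heis, e2, mk_eq_mk_iff'] at h2
  obtain ⟨a, ha⟩ := h1
  obtain ⟨b, hb⟩ := h2
  have hcol0 : ∀ i, A i 0 = a * (![1, 0, 0] : C21) i := fun i => by
    have := congrFun ha i
    simp [Matrix.mulVec, dotProduct, Fin.sum_univ_three] at this
    exact this.symm
  have hcol2 : ∀ i, A i 2 = b * (![0, 0, 1] : C21) i := fun i => by
    have := congrFun hb i
    simp [Matrix.mulVec, dotProduct, Fin.sum_univ_three] at this
    exact this.symm
  -- Fixing ∞ and 0 determines the outer columns up to scalars a and b; these pairings make the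
  -- matrix diagonal, with a b̄ = 1 and a middle entry of modulus 1.
  have g02 := hA ![1, 0, 0] ![0, 0, 1]
  have g11 := hA ![0, 1, 0] ![0, 1, 0]
  have g10 := hA ![0, 1, 0] ![1, 0, 0]
  have g12 := hA ![0, 1, 0] ![0, 0, 1]
  simp [herm_apply, Matrix.mulVec, dotProduct, Fin.sum_univ_three, hcol0, hcol2] at g02 g11 g10 g12
  have ha0 : a ≠ 0 := by rintro rfl; simp at g02
  have hb0 : b ≠ 0 := by rintro rfl; simp at g02
  have h21 : A 2 1 = 0 := by simpa [ha0] using g10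
  have h01 : A 0 1 = 0 := by simpa [hb0] using g12
  simp [h21, h01] at g11
  have h11 : A 1 1 ≠ 0 := by intro h; simp [h] at g11
  -- Scaling the last entry to 1 leaves A₁₁/b in the middle and a/b = 1/|b|² = |c|² on top.
  refine ⟨A 1 1 / b, div_ne_zero h11 hb0, fun z t => ?_⟩
  rw [heis, heis]
  obtain ⟨hy, e⟩ := hg ![-((‖z‖ ^ 2 : ℝ) : ℂ) + Complex.I * (t : ℂ),
      ((√2 : ℝ) : ℂ) * z, 1] (fun h => one_ne_zero (congrFun h 2))
  rw [e, mk_eq_mk_iff']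
  refine ⟨b, ?_⟩
  have hbb := Complex.mul_conj' b
  have hnb : (‖b‖ : ℂ) ≠ 0 := by simpa using hb0
  have hn11 : ‖A 1 1‖ = 1 := by
    rw [Complex.mul_conj', ← Complex.ofReal_pow] at g11
    have : ‖A 1 1‖ ^ 2 = 1 := by exact_mod_cast g11
    exact (pow_eq_one_iff_of_nonneg (norm_nonneg _) two_ne_zero).1 this
  have hab : b = a * (‖b‖ : ℂ) ^ 2 := by
    linear_combination (-b) * g02 + a * hbb
  ext i
  fin_cases i
  · simp [Matrix.mulVec, dotProduct, Fin.sum_univ_three, hcol0, hcol2, h01, hn11]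
    field_simp
    linear_combination (-(‖z‖ : ℂ) ^ 2 + Complex.I * t) * hab
  · simp [Matrix.mulVec, dotProduct, Fin.sum_univ_three, hcol0, hcol2]
    field_simp
  · simp [Matrix.mulVec, dotProduct, Fin.sum_univ_three, hcol0, hcol2, h21]

end Boundary

/-! ### The configuration space -/

section Configurations

open Projectivization

lemma mem_of_submodule_mk_le {v : C21} {hv : v ≠ 0} {W : Submodule ℂ C21} :
    (mk ℂ v hv).submodule ≤ W ↔ v ∈ W := by
  rw [submodule_mk, Submodule.span_singleton_le_iff_mem]

lemma OnCCircle.smul (g : PU21) {p q s : ℙ ℂ C21} (h : OnCCircle p q s) :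
    OnCCircle (g • p) (g • q) (g • s) := by
  obtain ⟨_, ⟨W, hW, ⟨v, hv, hneg⟩, rfl⟩, hp, hq, hs⟩ := h
  obtain ⟨⟨g, A, hA, rfl⟩, rfl⟩ : ∃ g', g' = g := ⟨g, rfl⟩
  let L : C21 ≃ₗ[ℂ] C21 := Matrix.toLinearEquiv' (A : Matrix (Fin 3) (Fin 3) ℂ) A.invertible
  have hL : ∀ x, L x = (A : Matrix (Fin 3) (Fin 3) ℂ).mulVec x := fun x => rfl
  refine ⟨_, ⟨W.map L.toLinearMap, ?_, ⟨L v, Submodule.mem_map_of_mem hv, ?_⟩, rfl⟩, ?_⟩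
  · rw [← hW]
    exact L.finrank_map_eq W
  · rw [hL, herm_mulVec hA]; exact hneg
  · have key : ∀ {x : ℙ ℂ C21}, x ∈ boundary ∧ x.submodule ≤ W →
        (⟨.mk A, A, hA, rfl⟩ : PU21) • x ∈ boundary ∧
        ((⟨.mk A, A, hA, rfl⟩ : PU21) • x).submodule ≤ W.map L.toLinearMap := by
      rintro x ⟨hx, hxW⟩
      refine ⟨smul_mem_boundary _ hx, ?_⟩
      induction x using Projectivization.ind with | _ y hy
      rw [mem_of_submodule_mk_le] at hxW
      have hy' : (A : Matrix (Fin 3) (Fin 3) ℂ).mulVec y ≠ 0 := (smul_ne_zero_iff_ne A).2 hy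
      change (mk ℂ ((A : Matrix (Fin 3) (Fin 3) ℂ).mulVec y) hy').submodule ≤ _
      rw [mem_of_submodule_mk_le]
      exact Submodule.mem_map_of_mem (f := L.toLinearMap) hxW
    exact ⟨key hp, key hq, key hs⟩

lemma onCCircle_smul_iff (g : PU21) {p q s : ℙ ℂ C21} :
    OnCCircle (g • p) (g • q) (g • s) ↔ OnCCircle p q s := by
  refine ⟨fun h => ?_, fun h => h.smul g⟩
  simpa using h.smul g⁻¹

lemma OnCCircle.rotate {p q s : ℙ ℂ C21} (h : OnCCircle p q s) : OnCCircle q s p := by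
  obtain ⟨C, hC, hp, hq, hs⟩ := h
  exact ⟨C, hC, hq, hs, hp⟩

/-- The complex line through ∞ and 0 is the vanishing of the middle coordinate. For z ≠ 0 the three
lifts span ℂ³, so no complex line contains them. -/
lemma onCCircle_infty_zero_heis {z : ℂ} {t : ℝ} :
    OnCCircle inftyPt (heis 0 0) (heis z t) ↔ z = 0 := by
  constructor
  · rintro ⟨_, ⟨W, hW, -, rfl⟩, ⟨-, h1⟩, ⟨-, h2⟩, ⟨-, h3⟩⟩
    rw [inftyPt, mem_of_submodule_mk_le] at h1
    rw [heis, mem_of_submodule_mk_le] at h2 h3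
    by_contra hz
    have htop : W = ⊤ := by
      rw [eq_top_iff]
      intro x _
      have := ofReal_sqrt_two_ne_zero
      have e : x = (x 0 - x 1 * (-((‖z‖ ^ 2 : ℝ) : ℂ) + Complex.I * (t : ℂ)) / (√2 * z)) •
          (![1, 0, 0] : C21) + (x 1 / (√2 * z)) •
          (![-((‖z‖ ^ 2 : ℝ) : ℂ) + Complex.I * (t : ℂ), ((√2 : ℝ) : ℂ) * z, 1] : C21) +
          (x 2 - x 1 / (√2 * z)) • (![-((‖(0 : ℂ)‖ ^ 2 : ℝ) : ℂ) + Complex.I * ((0 : ℝ) : ℂ),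
          ((√2 : ℝ) : ℂ) * 0, 1] : C21) := by
        ext i
        fin_cases i <;> simp <;> field_simp
        ring
      rw [e]
      exact W.add_mem (W.add_mem (W.smul_mem _ h1) (W.smul_mem _ h3)) (W.smul_mem _ h2)
    rw [htop, finrank_top] at hW
    simp at hW
  · rintro rfl
    let W : Submodule ℂ C21 := LinearMap.ker (LinearMap.proj 1 : C21 →ₗ[ℂ] ℂ)
    have hW : Module.finrank ℂ W = 2 := by
      have h := LinearMap.finrank_range_add_finrank_ker (LinearMap.proj 1 : C21 →ₗ[ℂ] ℂ)
      rw [LinearMap.range_eq_top.2 (LinearMap.proj_surjective 1), finrank_top] at h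
      simp at h
      change 1 + Module.finrank ℂ W = 3 at h
      omega
    refine ⟨_, ⟨W, hW, ⟨![1, 0, -1], by simp [W], by simp [herm_apply]⟩, rfl⟩,
      ⟨inftyPt_mem_boundary, ?_⟩, ⟨heis_mem_boundary _ _, ?_⟩, ⟨heis_mem_boundary _ _, ?_⟩⟩
    · rw [inftyPt, mem_of_submodule_mk_le]; simp [W]
    · rw [heis, mem_of_submodule_mk_le]; simp [W]
    · rw [heis, mem_of_submodule_mk_le]; simp [W]

/-- The orbit condition is carried along by conjugating the stabiliser, k ↦ g⁻¹kg. -/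
lemma smul_mem_C4'' (g : PU21) {p : Fin 4 → ℙ ℂ C21} (hp : p ∈ C4'') : g • p ∈ C4'' := by
  obtain ⟨⟨hinj, hb⟩, h1, h2, h3⟩ := hp
  refine ⟨⟨fun i j h => hinj (MulAction.injective g h), fun i => smul_mem_boundary g (hb i)⟩,
    fun h => h1 ((onCCircle_smul_iff g).1 h), fun h => h2 ((onCCircle_smul_iff g).1 h), ?_⟩
  rintro ⟨⟨k, hk1, hk2⟩, hk⟩
  have hk1' : k • g • p 1 = g • p 1 := hk1
  have hk2' : k • g • p 2 = g • p 2 := hk2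
  have hk' : k • g • p 0 = g • p 3 := hk
  refine h3 ⟨⟨g⁻¹ * k * g, ?_, ?_⟩, ?_⟩
  · change (g⁻¹ * k * g) • p 1 = p 1
    rw [mul_smul, mul_smul, hk1', inv_smul_smul]
  · change (g⁻¹ * k * g) • p 2 = p 2
    rw [mul_smul, mul_smul, hk2', inv_smul_smul]
  · change (g⁻¹ * k * g) • p 0 = p 3
    rw [mul_smul, mul_smul, hk', inv_smul_smul]

lemma config_eq_iff {p q : Fin 4 → ℙ ℂ C21} : config p = config q ↔ ∃ g : PU21, g • q = p := by
  rw [config, config, Quotient.eq]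
  rfl

lemma config_smul (g : PU21) (p : Fin 4 → ℙ ℂ C21) : config (g • p) = config p :=
  config_eq_iff.2 ⟨g, rfl⟩

/-- An element fixing ∞ and 0 takes (1, tan a) to (c, |c|² tan a), so reaching (z, t) forces c = z
and t = |z|² tan a. The case of the identity gives p₁ ≠ p₄. -/
lemma normalQuad_mem_C4''_iff {a : ℝ} {z : ℂ} {t : ℝ} :
    normalQuad a z t ∈ C4'' ↔ z ≠ 0 ∧ Real.tan a ≠ t / ‖z‖ ^ 2 := by
  constructor
  · rintro ⟨-, -, h2, h3⟩
    have hz : z ≠ 0 := fun hz => h2 (onCCircle_infty_zero_heis.2 hz)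
    refine ⟨hz, fun h => h3 ?_⟩
    obtain ⟨g, hg1, hg⟩ := exists_dilation hz
    refine ⟨⟨g, hg1, ?_⟩, ?_⟩
    · change g • heis 0 0 = heis 0 0
      rw [hg, mul_zero, mul_zero]
    · change g • heis 1 (Real.tan a) = heis z t
      have : ‖z‖ ≠ 0 := norm_ne_zero_iff.2 hz
      rw [hg, mul_one, h]
      congr 1
      field_simp
  · rintro ⟨hz, ht⟩
    have hne : ∀ {g : PU21}, g • inftyPt = inftyPt → g • heis 0 0 = heis 0 0 →
        g • heis 1 (Real.tan a) ≠ heis z t := by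
      intro g hg1 hg2 h
      obtain ⟨c, hc, hg⟩ := exists_dilation_of_fixed hg1 hg2
      rw [hg] at h
      obtain ⟨e1, e2⟩ := heis_injective h
      rw [mul_one] at e1
      subst e1
      have : ‖c‖ ≠ 0 := norm_ne_zero_iff.2 hz
      exact ht (by rw [← e2]; field_simp)
    have h01 : heis 1 (Real.tan a) ≠ inftyPt := heis_ne_inftyPt _ _
    have h02 : heis 1 (Real.tan a) ≠ heis 0 0 := fun h => one_ne_zero (heis_injective h).1
    have h03 : heis 1 (Real.tan a) ≠ heis z t := by
      simpa using hne (g := 1) (one_smul _ _) (one_smul _ _)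
    have h12 : inftyPt ≠ heis 0 0 := (heis_ne_inftyPt _ _).symm
    have h13 : inftyPt ≠ heis z t := (heis_ne_inftyPt _ _).symm
    have h23 : heis 0 0 ≠ heis z t := fun h => hz (heis_injective h).1.symm
    refine ⟨⟨?_, ?_⟩, ?_, ?_, ?_⟩
    · intro i j h
      fin_cases i <;> fin_cases j <;> simp [normalQuad] at h ⊢
      exacts [h01 h, h02 h, h03 h, h01 h.symm, h12 h, h13 h, h02 h.symm, h12 h.symm, h23 h,
        h03 h.symm, h13 h.symm, h23 h.symm]
    · intro i
      fin_cases i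
      exacts [heis_mem_boundary _ _, inftyPt_mem_boundary, heis_mem_boundary _ _,
        heis_mem_boundary _ _]
    · exact fun h => one_ne_zero (onCCircle_infty_zero_heis.1 h.rotate)
    · exact fun h => hz (onCCircle_infty_zero_heis.1 h)
    · rintro ⟨⟨g, hg1, hg2⟩, hg⟩
      exact hne hg1 hg2 hg

lemma exists_normalQuad (c : F4'') :
    ∃ a ∈ Set.Ioo (-(Real.pi / 2)) (Real.pi / 2), ∃ (z : ℂ) (t : ℝ),
      normalQuad a z t ∈ C4'' ∧ config (normalQuad a z t) = c.1 := by
  obtain ⟨_, p, hp, rfl⟩ := c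
  obtain ⟨⟨hinj, hb⟩, h1, -, -⟩ := id hp
  obtain ⟨g, hg1, hg2⟩ := exists_smul_eq_inftyPt_and_heis (hb 1) (hb 2)
    (hinj.ne (by decide : (1 : Fin 4) ≠ 2))
  have heis_of_ne : ∀ i, i ≠ 1 → ∃ z t, g • p i = heis z t := fun i hi =>
    (eq_inftyPt_or_heis (smul_mem_boundary g (hb i))).resolve_left fun h =>
      hinj.ne hi (MulAction.injective g (h.trans hg1.symm))
  obtain ⟨z₀, t₀, h₀⟩ := heis_of_ne 0 (by decide)
  obtain ⟨z₃, t₃, h₃⟩ := heis_of_ne 3 (by decide)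
  have hz₀ : z₀ ≠ 0 := by
    intro hz
    refine h1 ((onCCircle_smul_iff g).1 ?_)
    rw [h₀, hg1, hg2]
    exact (onCCircle_infty_zero_heis.2 hz).rotate.rotate
  -- The factor c = 1/z₀ moves (z₀, t₀) to (1, t₀/|z₀|²), whence the choice of a as an arctangent.
  obtain ⟨k, hk1, hk⟩ := exists_dilation (inv_ne_zero hz₀)
  have e : normalQuad (Real.arctan (‖z₀⁻¹‖ ^ 2 * t₀)) (z₀⁻¹ * z₃) (‖z₀⁻¹‖ ^ 2 * t₃) =
      k • g • p := by
    ext i : 1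
    fin_cases i
    · change heis 1 _ = k • g • p 0
      rw [h₀, hk, inv_mul_cancel₀ hz₀, Real.tan_arctan]
    · change inftyPt = k • g • p 1
      rw [hg1, hk1]
    · change heis 0 0 = k • g • p 2
      rw [hg2, hk, mul_zero, mul_zero]
    · change heis _ _ = k • g • p 3
      rw [h₃, hk]
  refine ⟨_, Real.arctan_mem_Ioo _, _, _, e ▸ smul_mem_C4'' k (smul_mem_C4'' g hp), ?_⟩
  rw [e, config_smul, config_smul]

/-- An element relating two normal forms fixes ∞ and 0, and comparing the first points gives c = 1.
-/
lemma config_normalQuad_injective {a b : ℝ} {z w : ℂ} {t s : ℝ}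
    (h : config (normalQuad a z t) = config (normalQuad b w s)) :
    Real.tan a = Real.tan b ∧ z = w ∧ t = s := by
  obtain ⟨g, hg⟩ := config_eq_iff.1 h
  have h0 : g • heis 1 (Real.tan b) = heis 1 (Real.tan a) := congrFun hg 0
  have h1 : g • inftyPt = inftyPt := congrFun hg 1
  have h2 : g • heis 0 0 = heis 0 0 := congrFun hg 2
  have h3 : g • heis w s = heis z t := congrFun hg 3
  obtain ⟨c, hc, hcg⟩ := exists_dilation_of_fixed h1 h2
  rw [hcg] at h0 h3
  obtain ⟨e1, e2⟩ := heis_injective h0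
  obtain ⟨e3, e4⟩ := heis_injective h3
  rw [mul_one] at e1
  subst e1
  simp only [norm_one, one_pow, one_mul] at e2 e3 e4
  exact ⟨e2.symm, e3.symm, e4.symm⟩

/-- The map is defined by chosen normal forms; uniqueness of the normal form makes its value
independent of the choice. Surjectivity uses a = arctan(log r). -/
lemma exists_bijection : ∃ B₀ : F4'' → cone', Function.Bijective B₀ ∧
    ∀ (c : F4''), ∀ a ∈ Set.Ioo (-(Real.pi / 2)) (Real.pi / 2), ∀ (z : ℂ) (t : ℝ),
      config (normalQuad a z t) = c.1 →
        (B₀ c : ConeSpace) = ((z, t), Real.exp (Real.tan a)) := by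
  choose a ha z t hC hc using exists_normalQuad
  let B₀ : F4'' → cone' := fun c => ⟨((z c, t c), Real.exp (Real.tan (a c))), by
    obtain ⟨h1, h2⟩ := normalQuad_mem_C4''_iff.1 (hC c)
    exact ⟨⟨h1, Real.exp_pos _⟩, by rwa [Real.log_exp]⟩⟩
  have hB : ∀ (c : F4'') (a : ℝ) (z : ℂ) (t : ℝ), config (normalQuad a z t) = c.1 →
      (B₀ c : ConeSpace) = ((z, t), Real.exp (Real.tan a)) := by
    intro c a' z' t' h
    obtain ⟨e1, e2, e3⟩ := config_normalQuad_injective ((hc c).trans h.symm)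
    simp only [B₀, e1, e2, e3]
  refine ⟨B₀, ⟨fun c d h => ?_, fun q => ?_⟩, fun c a' _ z' t' h => hB c a' z' t' h⟩
  · have h' := congrArg Subtype.val h
    simp only [B₀, Prod.mk.injEq, Real.exp_eq_exp] at h'
    obtain ⟨⟨e1, e2⟩, e3⟩ := h'
    apply Subtype.ext
    rw [← hc c, ← hc d, normalQuad, normalQuad, e1, e2, e3]
  · obtain ⟨⟨⟨w, s⟩, r⟩, ⟨hw, hr⟩, hlog⟩ := q
    have hmem : normalQuad (Real.arctan (Real.log r)) w s ∈ C4'' := by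
      rw [normalQuad_mem_C4''_iff, Real.tan_arctan]
      exact ⟨hw, hlog⟩
    refine ⟨⟨_, _, hmem, rfl⟩, Subtype.ext ?_⟩
    rw [hB _ _ _ _ rfl, Real.tan_arctan, Real.exp_log hr]

lemma exists_kahlerIso (B : F4'' ≃ cone') (hU : ∀ q : cone', q.1 ∈ cone) :
    ∃ (_ : TopologicalSpace F4'') (_ : ChartedSpace ConeSpace F4'')
      (_ : IsManifold 𝓘(ℝ, ConeSpace) ∞ F4'') (L : KahlerStructure F4''),
      IsKahlerIso L ((isGlobalChart_opens cone').kahlerStructure hU) B := by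
  let _ : TopologicalSpace F4'' := .induced B inferInstance
  let H : F4'' ≃ₜ cone' := B.toHomeomorphOfIsInducing ⟨rfl⟩
  have hι : Topology.IsOpenEmbedding (fun c => (B c : ConeSpace)) :=
    cone'.isOpenEmbedding'.comp H.isOpenEmbedding
  -- The one-chart structure needs a point: at z = 1, t = 0, r = e one has log r = 1 ≠ 0.
  have : Nonempty F4'' := ⟨B.symm ⟨((1, 0), Real.exp 1), ⟨one_ne_zero, Real.exp_pos 1⟩, by simp⟩⟩
  let _ := hι.singletonChartedSpace
  have _ : IsManifold 𝓘(ℝ, ConeSpace) ∞ F4'' := hι.isManifold_singleton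
  exact ⟨_, _, ‹_›, (isGlobalChart_singleton hι).kahlerStructure fun c => hU (B c),
    (isGlobalChart_singleton hι).isKahlerIso (isGlobalChart_opens cone') _ hU B fun _ => rfl⟩

end Configurations

end ConfKahler

end

open ConfKahler in
theorem mainTheorem1 :
    (∃ K : KahlerStructure cone, IsConeStructure cone K) ∧
    ∃ K' : KahlerStructure cone', IsConeStructure cone' K' ∧
    ∃ B₀ : F4'' → cone', Function.Bijective B₀ ∧
      (∀ c : F4'', ∃ a ∈ Set.Ioo (-(Real.pi / 2)) (Real.pi / 2), ∃ (z : ℂ) (t : ℝ),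
        normalQuad a z t ∈ C4'' ∧ config (normalQuad a z t) = c.1) ∧
      (∀ (c : F4''), ∀ a ∈ Set.Ioo (-(Real.pi / 2)) (Real.pi / 2), ∀ (z : ℂ) (t : ℝ),
        config (normalQuad a z t) = c.1 →
          (B₀ c : ConeSpace) = ((z, t), Real.exp (Real.tan a))) ∧
      ∃ (_ : TopologicalSpace F4'') (_ : ChartedSpace ConeSpace F4'')
        (_ : IsManifold 𝓘(ℝ, ConeSpace) ∞ F4'') (L : KahlerStructure F4''),
        IsKahlerIso L K' B₀ := by
  have hU : ∀ q : cone', q.1 ∈ cone := fun q => q.2.1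
  obtain ⟨B₀, hB, hB'⟩ := exists_bijection
  exact ⟨⟨_, isConeStructure_opens fun q => q.2⟩, _, isConeStructure_opens hU, B₀, hB,
    exists_normalQuad, hB', exists_kahlerIso (Equiv.ofBijective B₀ hB) hU⟩
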